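/- **Type systems modulo.** Fix a set $\mathcal S$ of sorts and function symbols of fixed arities. Terms (up to renaming of bound variables) are $$M,N,T,U ::= s\in\mathcal S \mid x \mid M\,N \mid \lambda x{:}T.\,M \mid \Pi x{:}T.\,U \mid f(\vec M),$$ and $T\to U$ is the product $\Pi x{:}T.\,U$ with $x$ not free in $U$. A type system is given by $\mathcal A\subseteq\mathcal S^2$, $\mathcal P\subseteq\mathcal S^3$, a signature $\Sigma(f)=(\overrightarrow{x:T},U,s)$, written $\overrightarrow{x:T}\vdash f(\vec x):U:s$, and a conversion $\equiv$. Its judgements $\Gamma\vdash \mathrm{WF}$ and $\Gamma\vdash M:T$ are derived by the rules * $\varnothing\vdash \mathrm{WF}$; if $\Gamma\vdash T:s$ and $v\notin\Gamma$ then $\Gamma,v{:}T\vdash \mathrm{WF}$; * if $\Gamma\vdash \mathrm{WF}$ then $\Gamma\vdash v:T$ for $(v{:}T)\in\Gamma$, and $\Gamma\vdash s_1:s_2$ for $(s_1,s_2)\in\mathcal A$; * if $\Gamma\vdash M:U$, $\Gamma\vdash T:s$ and $T\equiv U$, then $\Gamma\vdash M:T$; * if $\Gamma\vdash T:s_1$,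 $\Gamma,x{:}T\vdash U:s_2$ and $(s_1,s_2,s_3)\in\mathcal P$, then $\Gamma\vdash\Pi x{:}T.\,U:s_3$; * if $\Gamma\vdash\Pi x{:}T.\,U:s$ and $\Gamma,x{:}T\vdash M:U$, then $\Gamma\vdash\lambda x{:}T.\,M:\Pi x{:}T.\,U$; * if $\Gamma\vdash M:\Pi x{:}T.\,U$ and $\Gamma\vdash N:T$, then $\Gamma\vdash M\,N:U[x\mapsto N]$; * if $\Sigma(f)=(\overrightarrow{x:T},U,s)$, $\Gamma\vdash \mathrm{WF}$, $\overrightarrow{x:T}\vdash U:s$, and $\Gamma\vdash t_i:T_i[(x_j\mapsto t_j)_{j<i}]$ for all $i$, then $\Gamma\vdash f(\vec t):U[\overrightarrow{x\mapsto t}]$. **PVS-Cert** is the system with sorts $\mathrm{Prop},\mathrm{Type},\mathrm{Kind}$, with $\mathcal A=\{(\mathrm{Prop},\mathrm{Type}),(\mathrm{Type},\mathrm{Kind})\}$ and $\mathcal P=\{(\mathrm{Prop},\mathrm{Prop},\mathrm{Prop}),(\mathrm{Type},\mathrm{Type},\mathrm{Type}),(\mathrm{Type},\mathrm{Prop},\mathrm{Prop})\}$,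 with the signature * $T{:}\mathrm{Type},\,p{:}T\to\mathrm{Prop}\vdash \mathrm{psub}(T,p):\mathrm{Type}:\mathrm{Kind}$, * $T{:}\mathrm{Type},\,p{:}T\to\mathrm{Prop},\,m{:}T,\,h{:}p\,m\vdash \mathrm{pair}(T,p,m,h):\mathrm{psub}(T,p):\mathrm{Type}$, * $T{:}\mathrm{Type},\,p{:}T\to\mathrm{Prop},\,m{:}\mathrm{psub}(T,p)\vdash \mathrm{fst}(T,p,m):T:\mathrm{Type}$, * $T{:}\mathrm{Type},\,p{:}T\to\mathrm{Prop},\,m{:}\mathrm{psub}(T,p)\vdash \mathrm{snd}(T,p,m):p\,(\mathrm{fst}(T,p,m)):\mathrm{Prop}$, and with conversion the congruence generated by $$(\lambda x{:}T.\,M)\,N=M[x\mapsto N],\qquad \mathrm{pair}(t,u,m,h_0)=\mathrm{pair}(t,u,m,h_1),\qquad \mathrm{fst}(t_0,u_0,\mathrm{pair}(t_1,u_1,m,h))=m .$$ **The target** is the $\lambda\Pi$-calculus modulo the following theory. Its sorts are $\mathtt{TYPE},\mathtt{KIND}$, with $\mathcal A=\{(\mathtt{TYPE},\mathtt{KIND})\}$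 and $\mathcal P=\{(\mathtt{TYPE},\mathtt{TYPE},\mathtt{TYPE}),(\mathtt{TYPE},\mathtt{KIND},\mathtt{KIND})\}$. Its signature is * $\vdash\mathsf{Kind},\mathsf{Type},\mathsf{Prop}:\mathtt{TYPE}:\mathtt{KIND}$; $\ \vdash\mathsf{type}:\mathsf{Kind}:\mathtt{TYPE}$; $\ \vdash\mathsf{prop}:\mathsf{Type}:\mathtt{TYPE}$, * $t{:}\mathsf{Type}\vdash\mathsf{El}\,t:\mathtt{TYPE}:\mathtt{KIND}$; $\ p{:}\mathsf{Prop}\vdash\mathsf{Prf}\,p:\mathtt{TYPE}:\mathtt{KIND}$, * $t{:}\mathsf{Type},\,p{:}\mathsf{El}\,t\to\mathsf{Prop}\vdash\mathsf{all}\,t\,p:\mathsf{Prop}:\mathtt{TYPE}$, * $p{:}\mathsf{Prop},\,q{:}\mathsf{Prf}\,p\to\mathsf{Prop}\vdash\mathsf{imp}\,p\,q:\mathsf{Prop}:\mathtt{TYPE}$, * $t{:}\mathsf{Type},\,u{:}\mathsf{El}\,t\to\mathsf{Type}\vdash\mathsf{arr}\,t\,u:\mathsf{Type}:\mathtt{TYPE}$,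 * $t{:}\mathsf{Type},\,p{:}\mathsf{El}\,t\to\mathsf{Prop}\vdash\mathsf{psub}\,t\,p:\mathsf{Type}:\mathtt{TYPE}$, * $t{:}\mathsf{Type},\,p{:}\mathsf{El}\,t\to\mathsf{Prop},\,m{:}\mathsf{El}\,t,\,h{:}\mathsf{Prf}(p\,m)\vdash\mathsf{pair}\,t\,p\,m\,h:\mathsf{El}(\mathsf{psub}\,t\,p):\mathtt{TYPE}$, * $t{:}\mathsf{Type},\,p{:}\mathsf{El}\,t\to\mathsf{Prop},\,m{:}\mathsf{El}(\mathsf{psub}\,t\,p)\vdash\mathsf{fst}\,t\,p\,m:\mathsf{El}\,t:\mathtt{TYPE}$, and in the same context $\mathsf{snd}\,t\,p\,m:\mathsf{Prf}(p\,(\mathsf{fst}\,t\,p\,m)):\mathtt{TYPE}$. Its conversion is the congruence generated by the three equations above (with $\mathsf{pair},\mathsf{fst}$ for $\mathrm{pair},\mathrm{fst}$) and $$\mathsf{El}\,\mathsf{prop}=\mathsf{Prop},\quad \mathsf{Prf}(\mathsf{all}\,t\,p)=\Pi x{:}\mathsf{El}\,t.\,\mathsf{Prf}(p\,x),\quad \mathsf{Prf}(\mathsf{imp}\,p\,q)=\Pi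 h{:}\mathsf{Prf}\,p.\,\mathsf{Prf}(q\,h),\quad \mathsf{El}(\mathsf{arr}\,t\,u)=\Pi x{:}\mathsf{El}\,t.\,\mathsf{El}(u\,x).$$ **Translation.** The type translation is $[\![\mathrm{Kind}]\!]^{\mathrm{ty}}_\Gamma=\mathsf{Kind}$, $[\![\mathrm{Type}]\!]^{\mathrm{ty}}_\Gamma=\mathsf{Type}$, $[\![T]\!]^{\mathrm{ty}}_\Gamma=\mathsf{El}\,[\![T]\!]_\Gamma$ when $\Gamma\vdash T:\mathrm{Type}$, and $[\![T]\!]^{\mathrm{ty}}_\Gamma=\mathsf{Prf}\,[\![T]\!]_\Gamma$ when $\Gamma\vdash T:\mathrm{Prop}$ (in PVS-Cert). The term translation is $$[\![x]\!]_\Gamma=x,\quad [\![\mathrm{Prop}]\!]_\Gamma=\mathsf{prop},\quad [\![\mathrm{Type}]\!]_\Gamma=\mathsf{type},\quad [\![M\,N]\!]_\Gamma=[\![M]\!]_\Gamma\,[\![N]\!]_\Gamma,\quad [\![\lambda x{:}T.M]\!]_\Gamma=\lambda x{:}[\![T]\!]^{\mathrm{ty}}_\Gamma.\,[\![M]\!]_{\Gamma,x:T},$$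 $$[\![\Pi x{:}T.U]\!]_\Gamma=c\ [\![T]\!]_\Gamma\ (\lambda x{:}[\![T]\!]^{\mathrm{ty}}_\Gamma.\,[\![U]\!]_{\Gamma,x:T}),\qquad [\![f(t_1,\dots,t_n)]\!]_\Gamma=\mathsf f\,[\![t_1]\!]_\Gamma\cdots[\![t_n]\!]_\Gamma\ \text{ for } f\in\{\mathrm{psub},\mathrm{pair},\mathrm{fst},\mathrm{snd}\},$$ where $c=\mathsf{arr}$, $\mathsf{all}$ or $\mathsf{imp}$ according to whether the sorts of $T$ in $\Gamma$ and of $U$ in $\Gamma,x{:}T$ are $(\mathrm{Type},\mathrm{Type})$, $(\mathrm{Type},\mathrm{Prop})$ or $(\mathrm{Prop},\mathrm{Prop})$. On contexts, $[\![\varnothing]\!]=\varnothing$ and $[\![\Gamma,x{:}T]\!]=[\![\Gamma]\!],x{:}[\![T]\!]^{\mathrm{ty}}_\Gamma$. **Theorem (Correctness).** For all $\Gamma,M,T$: if $\Gamma\vdash M:T$ in PVS-Cert, then $[\![\Gamma]\!]\vdash[\![M]\!]_\Gamma:[\![T]\!]^{\mathrm{ty}}_\Gamma$ in the target system. For all $\Gamma$: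 if $\Gamma\vdash \mathrm{WF}$ in PVS-Cert, then $[\![\Gamma]\!]\vdash \mathrm{WF}$ in the target system. -/

import Mathlib

/-! ## Type systems modulo -/

namespace TSM

/-- Terms over a set `S` of sorts and a set `F` of function symbols of fixed arities `ar`, up to
renaming of bound variables: `var k` is the variable bound by the `k`-th enclosing binder,
or, beyond the binders of the term, by the corresponding entry of the context. -/
inductive Term (S F : Type) (ar : F → ℕ) : Type
  | sort (s : S) : Term S F ar
  | var (k : ℕ) : Term S F ar
  | app (M N : Term S F ar) : Term S F ar
  | lam (T M : Term S F ar) : Term S F ar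
  | pi (T U : Term S F ar) : Term S F ar
  | sym (f : F) (args : Fin (ar f) → Term S F ar) : Term S F ar

variable {S F : Type} {ar : F → ℕ}

/-- Lifting of a renaming under a binder. -/
def upRen (ρ : ℕ → ℕ) : ℕ → ℕ
  | 0 => 0
  | k + 1 => ρ k + 1

/-- Renaming of the free variables. -/
def Term.rename : Term S F ar → (ℕ → ℕ) → Term S F ar
  | .sort s, _ => .sort s
  | .var k, ρ => .var (ρ k)
  | .app M N, ρ => .app (M.rename ρ) (N.rename ρ)
  | .lam T M, ρ => .lam (T.rename ρ) (M.rename (upRen ρ))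
  | .pi T U, ρ => .pi (T.rename ρ) (U.rename (upRen ρ))
  | .sym f a, ρ => .sym f (fun i => (a i).rename ρ)

/-- Lifting of a substitution under a binder. -/
def upSubst (σ : ℕ → Term S F ar) : ℕ → Term S F ar
  | 0 => .var 0
  | k + 1 => (σ k).rename Nat.succ

/-- Simultaneous capture-avoiding substitution. -/
def Term.subst : Term S F ar → (ℕ → Term S F ar) → Term S F ar
  | .sort s, _ => .sort s
  | .var k, σ => σ k
  | .app M N, σ => .app (M.subst σ) (N.subst σ)
  | .lam T M, σ => .lam (T.subst σ) (M.subst (upSubst σ))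
  | .pi T U, σ => .pi (T.subst σ) (U.subst (upSubst σ))
  | .sym f a, σ => .sym f (fun i => (a i).subst σ)

/-- The substitution of `N` for the most recently bound variable. -/
def oneSubst (N : Term S F ar) : ℕ → Term S F ar
  | 0 => N
  | k + 1 => .var k

/-- `M[x ↦ N]` where `x` is the most recently bound variable. -/
def Term.inst (M N : Term S F ar) : Term S F ar := M.subst (oneSubst N)

/-- The non-dependent product `T → U`. -/
def Term.arrow (T U : Term S F ar) : Term S F ar := .pi T (U.rename Nat.succ)

/-- For arguments `t₀, …, tₙ₋₁`, the substitution `(x_j ↦ t_j)_{j < i}` acting on terms in a context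
`x₀, …, xᵢ₋₁` (in which `x_j` has index `i - 1 - j`). -/
def argSubst {n : ℕ} (t : Fin n → Term S F ar) (i : ℕ) : ℕ → Term S F ar := fun k =>
  if h : k < i ∧ i - 1 - k < n then t ⟨i - 1 - k, h.2⟩ else .var (k - i)

/-- Contexts; the most recent declaration comes first, and the type in an entry lives in the
context formed by the entries after it. -/
abbrev Ctx (S F : Type) (ar : F → ℕ) : Type := List (Term S F ar)

/-- The congruence generated by a set `E` of equations: the least equivalence relation that
contains `E` and is closed under all the term constructors. -/
inductive Cong (E : Term S F ar → Term S F ar → Prop) : Term S F ar → Term S F ar → Prop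
  | eqn {M N} : E M N → Cong E M N
  | refl (M) : Cong E M M
  | symm {M N} : Cong E M N → Cong E N M
  | trans {M N P} : Cong E M N → Cong E N P → Cong E M P
  | app {M M' N N'} : Cong E M M' → Cong E N N' → Cong E (.app M N) (.app M' N')
  | lam {T T' M M'} : Cong E T T' → Cong E M M' → Cong E (.lam T M) (.lam T' M')
  | pi {T T' U U'} : Cong E T T' → Cong E U U' → Cong E (.pi T U) (.pi T' U')
  | sym (f : F) {a a' : Fin (ar f) → Term S F ar} :
      (∀ i, Cong E (a i) (a' i)) → Cong E (.sym f a) (.sym f a')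

/-- The data that determine a type system modulo: sorting of sorts, product rules,
a typing signature `Σ(f) = (x₀ : T₀, …, xₙ₋₁ : Tₙ₋₁, U, s)` and a conversion relation.
`params f i` is `Tᵢ`, in context `x₀, …, xᵢ₋₁`, and `result f` is `U`, in context `x₀, …, xₙ₋₁`. -/
structure System (S F : Type) (ar : F → ℕ) where
  ax : S → S → Prop
  prodRule : S → S → S → Prop
  params : (f : F) → Fin (ar f) → Term S F ar
  result : F → Term S F ar
  resultSort : F → S
  conv : Term S F ar → Term S F ar → Prop

/-- The parameters of a symbol as a context `x₀ : T₀, …, xₙ₋₁ : Tₙ₋₁`. -/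
def System.paramCtx (X : System S F ar) (f : F) : Ctx S F ar := (List.ofFn (X.params f)).reverse

/-- The two forms of judgement: `Γ ⊢ WF` and `Γ ⊢ M : T`. -/
inductive Judgement (S F : Type) (ar : F → ℕ) : Type
  | wf (Γ : Ctx S F ar) : Judgement S F ar
  | typing (Γ : Ctx S F ar) (M T : Term S F ar) : Judgement S F ar

/-- The derivable judgements. -/
inductive System.Derives (X : System S F ar) : Judgement S F ar → Prop
  | empty : X.Derives (.wf [])
  | decl {Γ T s} :
      X.Derives (.typing Γ T (.sort s)) →
      X.Derives (.wf (T :: Γ))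
  | var {Γ k T} :
      X.Derives (.wf Γ) → Γ[k]? = some T →
      X.Derives (.typing Γ (.var k) (T.rename (· + (k + 1))))
  | conv {Γ M T U s} :
      X.Derives (.typing Γ M U) → X.Derives (.typing Γ T (.sort s)) → X.conv T U →
      X.Derives (.typing Γ M T)
  | sort {Γ s₁ s₂} :
      X.Derives (.wf Γ) → X.ax s₁ s₂ →
      X.Derives (.typing Γ (.sort s₁) (.sort s₂))
  | prod {Γ T U s₁ s₂ s₃} :
      X.Derives (.typing Γ T (.sort s₁)) → X.Derives (.typing (T :: Γ) U (.sort s₂)) →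
      X.prodRule s₁ s₂ s₃ →
      X.Derives (.typing Γ (.pi T U) (.sort s₃))
  | abst {Γ T U M s} :
      X.Derives (.typing Γ (.pi T U) (.sort s)) → X.Derives (.typing (T :: Γ) M U) →
      X.Derives (.typing Γ (.lam T M) (.pi T U))
  | app {Γ M N T U} :
      X.Derives (.typing Γ M (.pi T U)) → X.Derives (.typing Γ N T) →
      X.Derives (.typing Γ (.app M N) (U.inst N))
  | sig {Γ} (f : F) {t : Fin (ar f) → Term S F ar} :
      X.Derives (.wf Γ) →
      X.Derives (.typing (X.paramCtx f) (X.result f) (.sort (X.resultSort f))) →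
      (∀ i : Fin (ar f), X.Derives (.typing Γ (t i) ((X.params f i).subst (argSubst t i)))) →
      X.Derives (.typing Γ (.sym f t) ((X.result f).subst (argSubst t (ar f))))

/-- `Γ ⊢ WF` -/
abbrev System.WF (X : System S F ar) (Γ : Ctx S F ar) : Prop := X.Derives (.wf Γ)

/-- `Γ ⊢ M : T` -/
abbrev System.HasType (X : System S F ar) (Γ : Ctx S F ar) (M T : Term S F ar) : Prop :=
  X.Derives (.typing Γ M T)

end TSM

/-! ## PVS-Cert -/

namespace PVSCert

open TSM

inductive PSort : Type
  | prop | type | kind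

/-- Symbols for predicate subtypes, pairs, left projections and right projections. -/
inductive PSym : Type
  | psub | pair | fst | snd

@[reducible] def PSym.arity : PSym → ℕ
  | .psub => 2
  | .pair => 4
  | .fst => 3
  | .snd => 3

abbrev PTerm : Type := Term PSort PSym PSym.arity

abbrev PCtx : Type := Ctx PSort PSym PSym.arity

def psub (T p : PTerm) : PTerm := .sym .psub ![T, p]

def pair (T p m h : PTerm) : PTerm := .sym .pair ![T, p, m, h]

def fst (T p m : PTerm) : PTerm := .sym .fst ![T, p, m]

def snd (T p m : PTerm) : PTerm := .sym .snd ![T, p, m]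

inductive Ax : PSort → PSort → Prop
  | prop : Ax .prop .type
  | type : Ax .type .kind

inductive ProdRule : PSort → PSort → PSort → Prop
  | ppp : ProdRule .prop .prop .prop
  | ttt : ProdRule .type .type .type
  | tpp : ProdRule .type .prop .prop

/-- Types of the parameters:
* `psub` : `T : Type, p : T → Prop`
* `pair` : `T : Type, p : T → Prop, m : T, h : p m`
* `fst`, `snd` : `T : Type, p : T → Prop, m : psub T p` -/
def params : (f : PSym) → Fin f.arity → PTerm
  | .psub => ![.sort .type, .arrow (.var 0) (.sort .prop)]
  | .pair => ![.sort .type, .arrow (.var 0) (.sort .prop), .var 1, .app (.var 1) (.var 0)]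
  | .fst => ![.sort .type, .arrow (.var 0) (.sort .prop), psub (.var 1) (.var 0)]
  | .snd => ![.sort .type, .arrow (.var 0) (.sort .prop), psub (.var 1) (.var 0)]

/-- `psub T p : Type`, `pair T p m h : psub T p`, `fst T p m : T`, `snd T p m : p (fst T p m)`. -/
def result : PSym → PTerm
  | .psub => .sort .type
  | .pair => psub (.var 3) (.var 2)
  | .fst => .var 2
  | .snd => .app (.var 1) (fst (.var 2) (.var 1) (.var 0))

def resultSort : PSym → PSort
  | .psub => .kind
  | .pair => .type
  | .fst => .type
  | .snd => .prop

/-- The equations: β, proof irrelevance of pairs, and computation of the left projection. -/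
inductive Eqn : PTerm → PTerm → Prop
  | beta (T M N : PTerm) : Eqn (.app (.lam T M) N) (M.inst N)
  | pairIrrel (t u m h₀ h₁ : PTerm) : Eqn (pair t u m h₀) (pair t u m h₁)
  | fstPair (t₀ u₀ t₁ u₁ m h : PTerm) : Eqn (fst t₀ u₀ (pair t₁ u₁ m h)) m

/-- The type system PVS-Cert. -/
def system : System PSort PSym PSym.arity where
  ax := Ax
  prodRule := ProdRule
  params := params
  result := result
  resultSort := resultSort
  conv := Cong Eqn

end PVSCert

/-! ## The encoding of PVS-Cert in the λΠ-calculus modulo theory -/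

namespace LPEnc

open TSM PVSCert

/-- The sorts `TYPE` and `KIND`. -/
inductive LSort : Type
  | type | kind

/-- Symbols of the encoding. `cKind`, `cType`, `cProp` are the constants encoding sorts as types,
`oType`, `oProp` the constants encoding sorts as objects; `pcert f` is the counterpart of the symbol
`f` of PVS-Cert. -/
inductive LSym : Type
  | cKind | cType | cProp
  | oType | oProp
  | el | prf
  | all | imp | arr
  | pcert (f : PSym)

@[reducible] def LSym.arity : LSym → ℕ
  | .cKind => 0
  | .cType => 0
  | .cProp => 0
  | .oType => 0
  | .oProp => 0
  | .el => 1
  | .prf => 1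
  | .all => 2
  | .imp => 2
  | .arr => 2
  | .pcert f => f.arity

abbrev LTerm : Type := Term LSort LSym LSym.arity

abbrev LCtx : Type := Ctx LSort LSym LSym.arity

def cKind : LTerm := .sym .cKind ![]

def cType : LTerm := .sym .cType ![]

def cProp : LTerm := .sym .cProp ![]

def oType : LTerm := .sym .oType ![]

def oProp : LTerm := .sym .oProp ![]

def el (t : LTerm) : LTerm := .sym .el ![t]

def prf (p : LTerm) : LTerm := .sym .prf ![p]

def all (t p : LTerm) : LTerm := .sym .all ![t, p]

def imp (p q : LTerm) : LTerm := .sym .imp ![p, q]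

def arr (t u : LTerm) : LTerm := .sym .arr ![t, u]

def psub (t p : LTerm) : LTerm := .sym (.pcert .psub) ![t, p]

def pair (t p m h : LTerm) : LTerm := .sym (.pcert .pair) ![t, p, m, h]

def fst (t p m : LTerm) : LTerm := .sym (.pcert .fst) ![t, p, m]

def snd (t p m : LTerm) : LTerm := .sym (.pcert .snd) ![t, p, m]

inductive Ax : LSort → LSort → Prop
  | type : Ax .type .kind

inductive ProdRule : LSort → LSort → LSort → Prop
  | ttt : ProdRule .type .type .type
  | tkk : ProdRule .type .kind .kind

/-- Types of the parameters:
* `el` : `t : cType`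
* `prf` : `p : cProp`
* `all` : `t : cType, p : el t → cProp`
* `imp` : `p : cProp, q : prf p → cProp`
* `arr` : `t : cType, u : el t → cType`
* `psub` : `t : cType, p : el t → cProp`
* `pair` : `t : cType, p : el t → cProp, m : el t, h : prf (p m)`
* `fst`, `snd` : `t : cType, p : el t → cProp, m : el (psub t p)` -/
def params : (f : LSym) → Fin f.arity → LTerm
  | .cKind => ![]
  | .cType => ![]
  | .cProp => ![]
  | .oType => ![]
  | .oProp => ![]
  | .el => ![cType]
  | .prf => ![cProp]
  | .all => ![cType, .arrow (el (.var 0)) cProp]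
  | .imp => ![cProp, .arrow (prf (.var 0)) cProp]
  | .arr => ![cType, .arrow (el (.var 0)) cType]
  | .pcert .psub => ![cType, .arrow (el (.var 0)) cProp]
  | .pcert .pair =>
      ![cType, .arrow (el (.var 0)) cProp, el (.var 1), prf (.app (.var 1) (.var 0))]
  | .pcert .fst => ![cType, .arrow (el (.var 0)) cProp, el (psub (.var 1) (.var 0))]
  | .pcert .snd => ![cType, .arrow (el (.var 0)) cProp, el (psub (.var 1) (.var 0))]

/-- `cKind, cType, cProp : TYPE`, `oType : cKind`, `oProp : cType`, `el t, prf p : TYPE`,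
`all t p, imp p q : cProp`, `arr t u, psub t p : cType`, `pair t p m h : el (psub t p)`,
`fst t p m : el t`, `snd t p m : prf (p (fst t p m))`. -/
def result : LSym → LTerm
  | .cKind => .sort .type
  | .cType => .sort .type
  | .cProp => .sort .type
  | .oType => cKind
  | .oProp => cType
  | .el => .sort .type
  | .prf => .sort .type
  | .all => cProp
  | .imp => cProp
  | .arr => cType
  | .pcert .psub => cType
  | .pcert .pair => el (psub (.var 3) (.var 2))
  | .pcert .fst => el (.var 2)
  | .pcert .snd => prf (.app (.var 1) (fst (.var 2) (.var 1) (.var 0)))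

def resultSort : LSym → LSort
  | .cKind => .kind
  | .cType => .kind
  | .cProp => .kind
  | .oType => .type
  | .oProp => .type
  | .el => .kind
  | .prf => .kind
  | .all => .type
  | .imp => .type
  | .arr => .type
  | .pcert _ => .type

/-- The equations of the encoding; `p.rename Nat.succ` is `p` seen under one more binder. -/
inductive Eqn : LTerm → LTerm → Prop
  | beta (T M N : LTerm) : Eqn (.app (.lam T M) N) (M.inst N)
  | pairIrrel (t u m h₀ h₁ : LTerm) : Eqn (pair t u m h₀) (pair t u m h₁)
  | fstPair (t₀ u₀ t₁ u₁ m h : LTerm) : Eqn (fst t₀ u₀ (pair t₁ u₁ m h)) m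
  | elProp : Eqn (el oProp) cProp
  | prfAll (t p : LTerm) :
      Eqn (prf (all t p)) (.pi (el t) (prf (.app (p.rename Nat.succ) (.var 0))))
  | prfImp (p q : LTerm) :
      Eqn (prf (imp p q)) (.pi (prf p) (prf (.app (q.rename Nat.succ) (.var 0))))
  | elArr (t u : LTerm) :
      Eqn (el (arr t u)) (.pi (el t) (el (.app (u.rename Nat.succ) (.var 0))))

/-- The λΠ-calculus modulo the theory of the encoding. -/
def system : System LSort LSym LSym.arity where
  ax := Ax
  prodRule := ProdRule
  params := params
  result := result
  resultSort := resultSort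
  conv := Cong Eqn

/-! ### The translation -/

/-- Value of the translation outside its domain. The sort `KIND` has no type in the λΠ-calculus. -/
def undef : LTerm := .sort .kind

open Classical in
/-- The type translation of `T` in context `Γ`, given the term translation `t` of `T`. The case
distinctions here and in `termTr` are between typings by different sorts, so that for well-typed
terms exactly one case applies. -/
noncomputable def typeTrOf (Γ : PCtx) (T : PTerm) (t : LTerm) : LTerm :=
  if T = .sort .kind then cKind
  else if T = .sort .type then cType
  else if PVSCert.system.HasType Γ T (.sort .type) then el t
  else if PVSCert.system.HasType Γ T (.sort .prop) then prf t
  else undef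

open Classical in
/-- The term translation `termTr M Γ` of `M` in context `Γ`. -/
noncomputable def termTr : PTerm → PCtx → LTerm
  | .var k, _ => .var k
  | .sort .prop, _ => oProp
  | .sort .type, _ => oType
  | .sort .kind, _ => undef
  | .app M N, Γ => .app (termTr M Γ) (termTr N Γ)
  | .lam T M, Γ => .lam (typeTrOf Γ T (termTr T Γ)) (termTr M (T :: Γ))
  | .pi T U, Γ =>
      if PVSCert.system.HasType Γ T (.sort .type) ∧
          PVSCert.system.HasType (T :: Γ) U (.sort .type) then
        arr (termTr T Γ) (.lam (typeTrOf Γ T (termTr T Γ)) (termTr U (T :: Γ)))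
      else if PVSCert.system.HasType Γ T (.sort .type) ∧
          PVSCert.system.HasType (T :: Γ) U (.sort .prop) then
        all (termTr T Γ) (.lam (typeTrOf Γ T (termTr T Γ)) (termTr U (T :: Γ)))
      else if PVSCert.system.HasType Γ T (.sort .prop) ∧
          PVSCert.system.HasType (T :: Γ) U (.sort .prop) then
        imp (termTr T Γ) (.lam (typeTrOf Γ T (termTr T Γ)) (termTr U (T :: Γ)))
      else undef
  | .sym f a, Γ => .sym (.pcert f) (fun i => termTr (a i) Γ)

/-- The type translation of `T` in context `Γ`. -/
noncomputable def typeTr (T : PTerm) (Γ : PCtx) : LTerm := typeTrOf Γ T (termTr T Γ)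

/-- The context translation. -/
noncomputable def ctxTr : PCtx → LCtx
  | [] => []
  | T :: Γ => typeTr T Γ :: ctxTr Γ

end LPEnc

/-!
The term translation inspects typings, so the difficulty is to show that it respects conversion,
which is generated by untyped equations and may pass through ill-typed terms. Two facts make this
manageable.

* Conversion of PVS-Cert has the Church-Rosser property on raw terms (`joinable_of_cong`). Proof
  irrelevance is oriented as the rewriting of the proof in a pair to a fixed constant, and the
  resulting parallel reduction has the diamond property (`Par.diamond`).
* Whether a typable term is a type, or else an expression, a proposition or a proof, can be read
  off its shape once the type variables of the context are known (`isTypeLevel`). The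
  translation can therefore be directed by these levels instead of typings (`tr`), which defines
  it on raw terms so that it commutes with substitution without any hypothesis (`tr_subst`).

A purely syntactic discipline, `WellLevelled`, is preserved by reduction, and the translation maps
a reduction of a well-levelled term to a conversion of the encoding (`wellLevelled_tr_of_par`).
With confluence, convertible well-levelled terms have convertible translations
(`isTypeLevel_tr_of_cong`); neither subject reduction nor uniqueness of types is needed.
Typable terms other than `Type` are well levelled, with the level announced by their sort
(`SortedDerives.levelTyping`), so on them the level-directed translation is the original one
(`termTr_eq`, `typeTr_eq`).

Preservation of typing is then an induction on derivations (`tr_correct`). In the application rule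
the codomain of the product has to be typed in the encoding, although it is not the subject of
a premise. The induction is thus on derivations whose rules for abstractions and applications
carry the typings of domain and codomain (`SortedDerives`). That every derivation can be so
decorated follows from the substitution lemma and the correctness of types.
-/

/-! ### Substitution calculus -/

namespace TSM

variable {S F : Type} {ar : F → ℕ}

theorem upRen_comp (ρ ρ' : ℕ → ℕ) : upRen ρ' ∘ upRen ρ = upRen (ρ' ∘ ρ) := by
  funext k; cases k <;> rfl

theorem Term.rename_rename (M : Term S F ar) :
    ∀ ρ ρ' : ℕ → ℕ, (M.rename ρ).rename ρ' = M.rename (ρ' ∘ ρ) := by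
  induction M <;> intro ρ ρ' <;> simp_all [Term.rename, upRen_comp]

theorem upSubst_comp_upRen (σ : ℕ → Term S F ar) (ρ : ℕ → ℕ) :
    upSubst σ ∘ upRen ρ = upSubst (σ ∘ ρ) := by
  funext k; cases k <;> rfl

theorem Term.rename_subst (M : Term S F ar) :
    ∀ (ρ : ℕ → ℕ) (σ : ℕ → Term S F ar), (M.rename ρ).subst σ = M.subst (σ ∘ ρ) := by
  induction M <;> intro ρ σ <;> simp_all [Term.rename, Term.subst, upSubst_comp_upRen]

theorem upSubst_rename (σ : ℕ → Term S F ar) (ρ : ℕ → ℕ) :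
    (fun k => (upSubst σ k).rename (upRen ρ)) = upSubst (fun k => (σ k).rename ρ) := by
  funext k
  cases k with
  | zero => rfl
  | succ k => simp only [upSubst, Term.rename_rename]; rfl

theorem Term.subst_rename (M : Term S F ar) :
    ∀ (σ : ℕ → Term S F ar) (ρ : ℕ → ℕ),
      (M.subst σ).rename ρ = M.subst (fun k => (σ k).rename ρ) := by
  induction M <;> intro σ ρ <;> simp_all [Term.rename, Term.subst, upSubst_rename]

theorem upSubst_subst (σ τ : ℕ → Term S F ar) :
    (fun k => (upSubst σ k).subst (upSubst τ)) = upSubst (fun k => (σ k).subst τ) := by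
  funext k
  cases k with
  | zero => rfl
  | succ k => simp only [upSubst, Term.rename_subst, Term.subst_rename]; rfl

theorem Term.subst_subst (M : Term S F ar) :
    ∀ σ τ : ℕ → Term S F ar, (M.subst σ).subst τ = M.subst (fun k => (σ k).subst τ) := by
  induction M <;> intro σ τ <;> simp_all [Term.subst, upSubst_subst]

theorem upSubst_var : upSubst (Term.var : ℕ → Term S F ar) = Term.var := by
  funext k; cases k <;> rfl

theorem Term.subst_var (M : Term S F ar) : M.subst Term.var = M := by
  induction M <;> simp_all [Term.subst, upSubst_var]

theorem upSubst_var_comp (ρ : ℕ → ℕ) :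
    upSubst (fun k => (Term.var (ρ k) : Term S F ar)) = fun k => Term.var (upRen ρ k) := by
  funext k; cases k <;> rfl

theorem Term.rename_eq_subst (M : Term S F ar) :
    ∀ ρ : ℕ → ℕ, M.rename ρ = M.subst (fun k => .var (ρ k)) := by
  induction M <;> intro ρ <;> simp_all [Term.rename, Term.subst, upSubst_var_comp]

theorem oneSubst_subst (N : Term S F ar) (σ : ℕ → Term S F ar) :
    (fun k => (upSubst σ k).subst (oneSubst (N.subst σ))) =
      fun k => (oneSubst N k).subst σ := by
  funext k
  cases k with
  | zero => rfl
  | succ k =>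
    simp only [upSubst, Term.rename_subst, oneSubst, Term.subst]
    exact Term.subst_var _

theorem Term.inst_subst (M N : Term S F ar) (σ : ℕ → Term S F ar) :
    (M.inst N).subst σ = (M.subst (upSubst σ)).inst (N.subst σ) := by
  simp only [Term.inst, Term.subst_subst, oneSubst_subst]

theorem Term.inst_rename (M N : Term S F ar) (ρ : ℕ → ℕ) :
    (M.inst N).rename ρ = (M.rename (upRen ρ)).inst (N.rename ρ) := by
  simp only [Term.rename_eq_subst, Term.inst_subst, upSubst_var_comp]

theorem Term.rename_succ_inst (M N : Term S F ar) : (M.rename Nat.succ).inst N = M := by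
  rw [Term.inst, Term.rename_subst]
  exact M.subst_var

theorem Term.rename_upRen_succ_inst (M : Term S F ar) :
    (M.rename (upRen Nat.succ)).inst (.var 0) = M := by
  rw [Term.inst, Term.rename_subst]
  refine Eq.trans (congrArg M.subst ?_) M.subst_var
  funext k; cases k <;> rfl

theorem Term.arrow_subst (T U : Term S F ar) (σ : ℕ → Term S F ar) :
    (Term.arrow T U).subst σ = Term.arrow (T.subst σ) (U.subst σ) := by
  simp only [Term.arrow, Term.subst, Term.rename_subst, Term.subst_rename]
  rfl

theorem Cong.subst {E : Term S F ar → Term S F ar → Prop}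
    (hE : ∀ M N σ, E M N → E (M.subst σ) (N.subst σ)) {M N : Term S F ar} (h : Cong E M N) :
    ∀ σ, Cong E (M.subst σ) (N.subst σ) := by
  induction h with
  | eqn h => exact fun σ => .eqn (hE _ _ σ h)
  | refl M => exact fun σ => .refl _
  | symm _ ih => exact fun σ => (ih σ).symm
  | trans _ _ ih ih' => exact fun σ => (ih σ).trans (ih' σ)
  | app _ _ ih ih' => exact fun σ => .app (ih σ) (ih' σ)
  | lam _ _ ih ih' => exact fun σ => .lam (ih σ) (ih' _)
  | pi _ _ ih ih' => exact fun σ => .pi (ih σ) (ih' _)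
  | sym f _ ih => exact fun σ => .sym f fun i => ih i σ

theorem System.HasType.wf {X : System S F ar} {Γ : Ctx S F ar} {M T : Term S F ar}
    (h : X.HasType Γ M T) : X.WF Γ := by
  suffices H : ∀ J, X.Derives J →
      match J with
      | .wf Γ => X.WF Γ
      | .typing Γ _ _ => X.WF Γ from H _ h
  intro J h
  induction h with
  | empty => exact .empty
  | decl h => exact .decl h
  | _ => assumption

end TSM

/-! ### Confluence of PVS-Cert -/

namespace PVSCert

open TSM

theorem psub_subst (T p : PTerm) (σ : ℕ → PTerm) :
    (psub T p).subst σ = psub (T.subst σ) (p.subst σ) := by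
  simp only [psub, Term.subst]; congr 1; funext i; fin_cases i <;> rfl

theorem pair_subst (T p m h : PTerm) (σ : ℕ → PTerm) :
    (pair T p m h).subst σ = pair (T.subst σ) (p.subst σ) (m.subst σ) (h.subst σ) := by
  simp only [pair, Term.subst]; congr 1; funext i; fin_cases i <;> rfl

theorem fst_subst (T p m : PTerm) (σ : ℕ → PTerm) :
    (fst T p m).subst σ = fst (T.subst σ) (p.subst σ) (m.subst σ) := by
  simp only [fst, Term.subst]; congr 1; funext i; fin_cases i <;> rfl

theorem Eqn.subst {M N : PTerm} (h : Eqn M N) (σ : ℕ → PTerm) :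
    Eqn (M.subst σ) (N.subst σ) := by
  cases h with
  | beta T M N => rw [Term.inst_subst]; exact .beta _ _ _
  | pairIrrel => simp only [pair_subst]; exact .pairIrrel _ _ _ _ _
  | fstPair => simp only [pair_subst, fst_subst]; exact .fstPair _ _ _ _ _ _

/-- Parallel reduction: any set of redexes present in a term is contracted at once. Proof
irrelevance is oriented by replacing the proof in a pair by the sort `Kind`. -/
inductive Par : PTerm → PTerm → Prop
  | sort (s) : Par (.sort s) (.sort s)
  | var (k) : Par (.var k) (.var k)
  | app {M M' N N'} : Par M M' → Par N N' → Par (.app M N) (.app M' N')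
  | lam {T T' M M'} : Par T T' → Par M M' → Par (.lam T M) (.lam T' M')
  | pi {T T' U U'} : Par T T' → Par U U' → Par (.pi T U) (.pi T' U')
  | sym (f : PSym) {a a' : Fin f.arity → PTerm} :
      (∀ i, Par (a i) (a' i)) → Par (.sym f a) (.sym f a')
  | beta {T M M' N N'} : Par M M' → Par N N' → Par (.app (.lam T M) N) (M'.inst N')
  | fstPair {a : Fin 3 → PTerm} {c : Fin 4 → PTerm} {m : PTerm} :
      a 2 = .sym .pair c → Par (c 2) m → Par (.sym .fst a) m
  | irrel {a a' : Fin 4 → PTerm} :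
      (∀ i, i ≠ 3 → Par (a i) (a' i)) → a' 3 = .sort .kind → Par (.sym .pair a) (.sym .pair a')

theorem Par.refl (M : PTerm) : Par M M := by
  induction M with
  | sort s => exact .sort s
  | var k => exact .var k
  | app _ _ ih ih' => exact .app ih ih'
  | lam _ _ ih ih' => exact .lam ih ih'
  | pi _ _ ih ih' => exact .pi ih ih'
  | sym f _ ih => exact .sym f ih

theorem Par.rename {M M' : PTerm} (h : Par M M') : ∀ ρ, Par (M.rename ρ) (M'.rename ρ) := by
  induction h with
  | sort s => exact fun ρ => .sort s
  | var k => exact fun ρ => .var _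
  | app _ _ ih ih' => exact fun ρ => .app (ih ρ) (ih' ρ)
  | lam _ _ ih ih' => exact fun ρ => .lam (ih ρ) (ih' _)
  | pi _ _ ih ih' => exact fun ρ => .pi (ih ρ) (ih' _)
  | sym f _ ih => exact fun ρ => .sym f fun i => ih i ρ
  | beta _ _ ih ih' =>
    intro ρ
    rw [Term.inst_rename]
    exact .beta (ih _) (ih' ρ)
  | @fstPair a c m ha _ ih =>
    exact fun ρ => .fstPair (c := fun i => (c i).rename ρ) (by simp [ha, Term.rename]) (ih ρ)
  | irrel _ h3 ih => exact fun ρ => .irrel (fun i hi => ih i hi ρ) (by simp [h3, Term.rename])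

theorem Par.upSubst {σ σ' : ℕ → PTerm} (h : ∀ k, Par (σ k) (σ' k)) (k : ℕ) :
    Par (upSubst σ k) (TSM.upSubst σ' k) := by
  cases k with
  | zero => exact .var 0
  | succ k => exact (h k).rename _

theorem Par.subst {M M' : PTerm} (h : Par M M') :
    ∀ {σ σ' : ℕ → PTerm}, (∀ k, Par (σ k) (σ' k)) → Par (M.subst σ) (M'.subst σ') := by
  induction h with
  | sort s => exact fun _ => .sort s
  | var k => exact fun h => h k
  | app _ _ ih ih' => exact fun h => .app (ih h) (ih' h)
  | lam _ _ ih ih' => exact fun h => .lam (ih h) (ih' (Par.upSubst h))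
  | pi _ _ ih ih' => exact fun h => .pi (ih h) (ih' (Par.upSubst h))
  | sym f _ ih => exact fun h => .sym f fun i => ih i h
  | beta _ _ ih ih' =>
    intro σ σ' h
    rw [Term.inst_subst]
    exact .beta (ih (Par.upSubst h)) (ih' h)
  | @fstPair a c m ha _ ih =>
    exact fun {σ _} h =>
      .fstPair (c := fun i => (c i).subst σ) (by simp [ha, Term.subst]) (ih h)
  | irrel _ h3 ih => exact fun h => .irrel (fun i hi => ih i hi h) (by simp [h3, Term.subst])

theorem Par.inst {M M' N N' : PTerm} (h : Par M M') (h' : Par N N') :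
    Par (M.inst N) (M'.inst N') := by
  refine h.subst fun k => ?_
  cases k with
  | zero => exact h'
  | succ k => exact .var k

theorem Par.sort_inv {s : PSort} {N : PTerm} (h : Par (.sort s) N) : N = .sort s := by
  cases h; rfl

theorem Par.lam_inv {T M N : PTerm} (h : Par (.lam T M) N) :
    ∃ T' M', N = .lam T' M' ∧ Par T T' ∧ Par M M' := by
  cases h with
  | lam h h' => exact ⟨_, _, rfl, h, h'⟩

theorem Par.pair_inv {a : Fin 4 → PTerm} {N : PTerm} (h : Par (.sym .pair a) N) :
    ∃ a' : Fin 4 → PTerm, N = .sym .pair a' ∧ ∀ i, i ≠ 3 → Par (a i) (a' i) := by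
  cases h with
  | sym _ h => exact ⟨_, rfl, fun i _ => h i⟩
  | irrel h _ => exact ⟨_, rfl, h⟩

/-- The critical pairs are those of a redex with a reduct of its own function part or projected
pair, and of the two ways to reduce a pair. -/
theorem Par.diamond {M N₁ : PTerm} (h₁ : Par M N₁) :
    ∀ {N₂}, Par M N₂ → ∃ P, Par N₁ P ∧ Par N₂ P := by
  induction h₁ with
  | sort s => exact fun h => ⟨_, .refl _, h.sort_inv ▸ .refl _⟩
  | var k => rintro _ ⟨⟩; exact ⟨_, .refl _, .refl _⟩
  | @app M M₁ N N₁ hM hN ihM ihN =>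
    intro N₂ h
    cases h with
    | app hM' hN' =>
      obtain ⟨P, h₁, h₂⟩ := ihM hM'
      obtain ⟨Q, h₃, h₄⟩ := ihN hN'
      exact ⟨_, .app h₁ h₃, .app h₂ h₄⟩
    | @beta T L L' _ N' hL hN' =>
      obtain ⟨T₁, L₁, rfl, -, -⟩ := hM.lam_inv
      obtain ⟨P, h₁, h₂⟩ := ihM (.lam (.refl T) hL)
      obtain ⟨Q, h₃, h₄⟩ := ihN hN'
      obtain ⟨T₂, L₂, rfl, -, h₅⟩ := h₁.lam_inv
      obtain ⟨T₃, L₃, h₆, -, h₇⟩ := h₂.lam_inv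
      cases h₆
      exact ⟨_, .beta h₅ h₃, h₇.inst h₄⟩
  | lam _ _ ih ih' =>
    intro N₂ h
    obtain ⟨T', M', rfl, hT, hM⟩ := h.lam_inv
    obtain ⟨P, h₁, h₂⟩ := ih hT
    obtain ⟨Q, h₃, h₄⟩ := ih' hM
    exact ⟨_, .lam h₁ h₃, .lam h₂ h₄⟩
  | pi _ _ ih ih' =>
    intro N₂ h
    cases h with
    | pi hT hM =>
      obtain ⟨P, h₁, h₂⟩ := ih hT
      obtain ⟨Q, h₃, h₄⟩ := ih' hM
      exact ⟨_, .pi h₁ h₃, .pi h₂ h₄⟩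
  | @sym f a a₁ h ih =>
    intro N₂ h'
    cases h' with
    | sym _ h' =>
      choose P h₁ h₂ using fun i => ih i (h' i)
      exact ⟨_, .sym f h₁, .sym f h₂⟩
    | @fstPair a c _ ha hm =>
      -- The induction hypothesis is available for the projected pair only, so the reduction of its
      -- third component is turned into a reduction of the pair.
      have hc : Par (a 2) (.sym .pair (Function.update c 2 N₂)) := by
        rw [ha]
        refine .sym _ fun i => ?_
        by_cases hi : i = 2
        · subst hi; simpa using hm
        · rw [Function.update_of_ne hi]; exact .refl _
      obtain ⟨P, h₁, h₂⟩ := ih 2 hc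
      obtain ⟨c₁, h₃, -⟩ := (ha ▸ h 2 : Par (.sym .pair c) (a₁ 2)).pair_inv
      rw [h₃] at h₁
      obtain ⟨d, rfl, h₄⟩ := h₁.pair_inv
      obtain ⟨d', h₅, h₆⟩ := h₂.pair_inv
      cases h₅
      refine ⟨d 2, .fstPair h₃ (h₄ 2 (by decide)), ?_⟩
      simpa using h₆ 2 (by decide)
    | @irrel _ a₂ h' h3 =>
      have : ∀ i : Fin 4, ∃ P, i ≠ 3 → Par (a₁ i) P ∧ Par (a₂ i) P := fun i => by
        by_cases hi : i = 3
        · exact ⟨a₁ i, fun h => (h hi).elim⟩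
        · obtain ⟨P, hP⟩ := ih i (h' i hi)
          exact ⟨P, fun _ => hP⟩
      choose P hP using this
      refine ⟨.sym .pair (Function.update P 3 (.sort .kind)),
        .irrel (fun i hi => ?_) (by simp), .irrel (fun i hi => ?_) (by simp)⟩
      · rw [Function.update_of_ne hi]; exact (hP i hi).1
      · rw [Function.update_of_ne hi]; exact (hP i hi).2
  | @beta T L L₁ N N₁ hL hN ihL ihN =>
    intro N₂ h
    cases h with
    | app hM' hN' =>
      obtain ⟨T₂, L₂, rfl, -, hL'⟩ := hM'.lam_inv
      obtain ⟨P, h₁, h₂⟩ := ihL hL'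
      obtain ⟨Q, h₃, h₄⟩ := ihN hN'
      exact ⟨_, h₁.inst h₃, .beta h₂ h₄⟩
    | beta hL' hN' =>
      obtain ⟨P, h₁, h₂⟩ := ihL hL'
      obtain ⟨Q, h₃, h₄⟩ := ihN hN'
      exact ⟨_, h₁.inst h₃, h₂.inst h₄⟩
  | @fstPair a c m ha hm ih =>
    intro N₂ h
    cases h with
    | @sym _ _ a₂ h =>
      obtain ⟨c', h₁, h₂⟩ := (ha ▸ h 2 : Par (.sym .pair c) (a₂ 2)).pair_inv
      obtain ⟨P, h₃, h₄⟩ := ih (h₂ 2 (by decide))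
      exact ⟨P, h₃, .fstPair h₁ h₄⟩
    | fstPair ha' hm' =>
      cases ha.symm.trans ha'
      exact ih hm'
  | @irrel a a₁ h h3 ih =>
    intro N₂ h'
    obtain ⟨a₂, rfl, h₂⟩ := h'.pair_inv
    have : ∀ i : Fin 4, ∃ P, i ≠ 3 → Par (a₁ i) P ∧ Par (a₂ i) P := fun i => by
      by_cases hi : i = 3
      · exact ⟨a₁ i, fun h => (h hi).elim⟩
      · obtain ⟨P, hP⟩ := ih i hi (h₂ i hi)
        exact ⟨P, fun _ => hP⟩
    choose P hP using this
    refine ⟨.sym .pair (Function.update P 3 (.sort .kind)),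
      .irrel (fun i hi => ?_) (by simp), .irrel (fun i hi => ?_) (by simp)⟩
    · rw [Function.update_of_ne hi]; exact (hP i hi).1
    · rw [Function.update_of_ne hi]; exact (hP i hi).2

/-- Two terms have a common reduct. -/
def Joinable (M N : PTerm) : Prop := Relation.Join (Relation.ReflTransGen Par) M N

theorem joinable_equivalence : Equivalence Joinable :=
  Relation.equivalence_join_reflTransGen fun _ _ _ h h' =>
    let ⟨P, h₁, h₂⟩ := h.diamond h'
    ⟨P, .single h₁, .single h₂⟩

theorem Joinable.of_par {M N : PTerm} (h : Par M N) : Joinable M N :=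
  ⟨N, .single h, .refl⟩

theorem Joinable.map {f : PTerm → PTerm} (hf : ∀ M N, Par M N → Par (f M) (f N)) {M N : PTerm}
    (h : Joinable M N) : Joinable (f M) (f N) :=
  let ⟨P, h₁, h₂⟩ := h
  ⟨f P, h₁.lift f hf, h₂.lift f hf⟩

theorem Joinable.map₂ {f : PTerm → PTerm → PTerm}
    (hf : ∀ M M' N N', Par M M' → Par N N' → Par (f M N) (f M' N')) {M M' N N' : PTerm}
    (h : Joinable M M') (h' : Joinable N N') : Joinable (f M N) (f M' N') :=
  joinable_equivalence.trans (h.map (f := (f · N)) fun _ _ h => hf _ _ _ _ h (.refl _))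
    (h'.map (f := f M') fun _ _ h => hf _ _ _ _ (.refl _) h)

theorem Joinable.sym (f : PSym) {a a' : Fin f.arity → PTerm} (h : ∀ i, Joinable (a i) (a' i)) :
    Joinable (.sym f a) (.sym f a') := by
  -- The arguments are exchanged one at a time.
  have key : ∀ s : Finset (Fin f.arity), Joinable (.sym f a) (.sym f (s.piecewise a' a)) := by
    intro s
    induction s using Finset.induction_on with
    | empty => simpa using joinable_equivalence.refl _
    | insert i s hi ih =>
      refine joinable_equivalence.trans ih ?_
      have := (h i).map (f := fun M => .sym f (Function.update (s.piecewise a' a) i M))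
        fun M N hMN => .sym f fun j => by
          by_cases hj : j = i
          · subst hj; simpa using hMN
          · simpa [Function.update_of_ne hj] using Par.refl _
      rw [Finset.piecewise_insert]
      convert this using 2
      rw [eq_comm, Function.update_eq_self_iff]
      simp [hi]
  simpa using key Finset.univ

/-- The Church-Rosser property. -/
theorem joinable_of_cong {M N : PTerm} (h : Cong Eqn M N) : Joinable M N := by
  induction h with
  | eqn h =>
    cases h with
    | beta T M N => exact .of_par (.beta (.refl _) (.refl _))
    | pairIrrel t u m h₀ h₁ =>
      have : ∀ h, Par (pair t u m h) (pair t u m (.sort .kind)) := fun h =>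
        .irrel (fun i hi => by fin_cases i <;> first | exact .refl _ | exact (hi rfl).elim) rfl
      exact ⟨_, .single (this h₀), .single (this h₁)⟩
    | fstPair t₀ u₀ t₁ u₁ m h => exact .of_par (.fstPair rfl (.refl _))
  | refl M => exact joinable_equivalence.refl M
  | symm _ ih => exact joinable_equivalence.symm ih
  | trans _ _ ih ih' => exact joinable_equivalence.trans ih ih'
  | app _ _ ih ih' => exact ih.map₂ (fun _ _ _ _ => .app) ih'
  | lam _ _ ih ih' => exact ih.map₂ (fun _ _ _ _ => .lam) ih'
  | pi _ _ ih ih' => exact ih.map₂ (fun _ _ _ _ => .pi) ih'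
  | sym f _ ih => exact .sym f ih

theorem eq_sort_of_reflTransGen_par {s : PSort} {N : PTerm}
    (h : Relation.ReflTransGen Par (.sort s) N) : N = .sort s := by
  induction h with
  | refl => rfl
  | tail _ h ih => subst ih; exact h.sort_inv

theorem reflTransGen_par_sort_of_cong {M : PTerm} {s : PSort} (h : Cong Eqn M (.sort s)) :
    Relation.ReflTransGen Par M (.sort s) := by
  obtain ⟨P, h₁, h₂⟩ := joinable_of_cong h
  rwa [eq_sort_of_reflTransGen_par h₂] at h₁

end PVSCert

/-! ### Levels and the level-directed translation -/

namespace PVSCert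

open TSM

/-- Extension of an assignment of levels by a bound variable, which never is a type variable. -/
def upLevel (b : ℕ → Bool) : ℕ → Bool
  | 0 => false
  | k + 1 => b k

/-- Whether a symbol builds types. -/
def formsType : PSym → Bool
  | .psub => true
  | _ => false

/-- Whether the shape of a term is that of a type, as opposed to an expression, a proposition or a
proof; `b` tells which free variables are type variables. -/
def isTypeLevel : PTerm → (ℕ → Bool) → Bool
  | .sort _, _ => true
  | .var k, b => b k
  | .app _ _, _ => false
  | .lam _ _, _ => false
  | .pi _ U, b => isTypeLevel U (upLevel b)
  | .sym f _, _ => formsType f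

/-- A term is well levelled if types occur in it only where PVS-Cert allows them: this is a coarse
typing discipline that does not involve conversion. The proof component of a pair is not
constrained, so that replacing it by `Kind` is harmless, and the sorts other than `Prop` are not
well levelled. -/
def WellLevelled : PTerm → (ℕ → Bool) → Prop
  | .sort s, _ => s = .prop
  | .var _, _ => True
  | .app M N, b =>
      (WellLevelled M b ∧ isTypeLevel M b = false) ∧ WellLevelled N b ∧ isTypeLevel N b = false
  | .lam T M, b =>
      WellLevelled T b ∧ WellLevelled M (upLevel b) ∧ isTypeLevel M (upLevel b) = false
  | .pi T U, b =>
      WellLevelled T b ∧ WellLevelled U (upLevel b) ∧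
        (isTypeLevel U (upLevel b) = true → isTypeLevel T b = true)
  | .sym f a, b =>
      ∀ i, (f = .pair → i.val ≠ 3) → WellLevelled (a i) b ∧ isTypeLevel (a i) b = decide (i.val = 0)

theorem upLevel_comp_upRen (b : ℕ → Bool) (ρ : ℕ → ℕ) :
    upLevel b ∘ upRen ρ = upLevel (b ∘ ρ) := by
  funext k; cases k <;> rfl

theorem isTypeLevel_rename (M : PTerm) :
    ∀ ρ b, isTypeLevel (M.rename ρ) b = isTypeLevel M (b ∘ ρ) := by
  induction M <;> intro ρ b <;> simp_all [Term.rename, isTypeLevel, upLevel_comp_upRen]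

theorem isTypeLevel_upSubst (σ : ℕ → PTerm) (b : ℕ → Bool) :
    (fun k => isTypeLevel (upSubst σ k) (upLevel b)) =
      upLevel fun k => isTypeLevel (σ k) b := by
  funext k
  cases k with
  | zero => rfl
  | succ k => exact isTypeLevel_rename _ _ _

theorem isTypeLevel_subst (M : PTerm) :
    ∀ σ b, isTypeLevel (M.subst σ) b = isTypeLevel M fun k => isTypeLevel (σ k) b := by
  induction M <;> intro σ b <;> simp_all [Term.subst, isTypeLevel, isTypeLevel_upSubst]

theorem isTypeLevel_oneSubst {N : PTerm} {b : ℕ → Bool} (hN : isTypeLevel N b = false) :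
    (fun k => isTypeLevel (oneSubst N k) b) = upLevel b := by
  funext k
  cases k with
  | zero => exact hN
  | succ k => rfl

theorem isTypeLevel_inst (M : PTerm) {N : PTerm} {b : ℕ → Bool} (hN : isTypeLevel N b = false) :
    isTypeLevel (M.inst N) b = isTypeLevel M (upLevel b) := by
  rw [Term.inst, isTypeLevel_subst, isTypeLevel_oneSubst hN]

theorem wellLevelled_rename (M : PTerm) :
    ∀ ρ b, WellLevelled (M.rename ρ) b ↔ WellLevelled M (b ∘ ρ) := by
  induction M <;> intro ρ b <;>
    simp_all [Term.rename, WellLevelled, isTypeLevel_rename, upLevel_comp_upRen]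

theorem WellLevelled.subst {M : PTerm} :
    ∀ {σ : ℕ → PTerm} {b}, WellLevelled M (fun k => isTypeLevel (σ k) b) →
      (∀ k, WellLevelled (σ k) b) → WellLevelled (M.subst σ) b := by
  have up : ∀ {σ : ℕ → PTerm} {b}, (∀ k, WellLevelled (σ k) b) →
      ∀ k, WellLevelled (upSubst σ k) (upLevel b) := by
    intro σ b h k
    cases k with
    | zero => trivial
    | succ k => exact (wellLevelled_rename _ _ _).2 (h k)
  induction M with
  | sort s => exact fun h _ => h
  | var k => exact fun _ h => h k
  | app M N ih ih' =>
    intro σ b h hσ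
    simp only [Term.subst, WellLevelled, isTypeLevel_subst] at h ⊢
    exact ⟨⟨ih h.1.1 hσ, h.1.2⟩, ih' h.2.1 hσ, h.2.2⟩
  | lam T M ih ih' =>
    intro σ b h hσ
    simp only [Term.subst, WellLevelled, isTypeLevel_subst, isTypeLevel_upSubst] at h ⊢
    exact ⟨ih h.1 hσ, ih' (isTypeLevel_upSubst σ b ▸ h.2.1) (up hσ), h.2.2⟩
  | pi T U ih ih' =>
    intro σ b h hσ
    simp only [Term.subst, WellLevelled, isTypeLevel_subst, isTypeLevel_upSubst] at h ⊢
    exact ⟨ih h.1 hσ, ih' (isTypeLevel_upSubst σ b ▸ h.2.1) (up hσ), h.2.2⟩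
  | sym f a ih =>
    intro σ b h hσ
    simp only [Term.subst, WellLevelled, isTypeLevel_subst] at h ⊢
    exact fun i hi => ⟨ih i (h i hi).1 hσ, (h i hi).2⟩

theorem WellLevelled.inst {M N : PTerm} {b : ℕ → Bool} (hM : WellLevelled M (upLevel b))
    (hN : WellLevelled N b) (hN' : isTypeLevel N b = false) : WellLevelled (M.inst N) b := by
  refine WellLevelled.subst (isTypeLevel_oneSubst hN' ▸ hM) fun k => ?_
  cases k with
  | zero => exact hN
  | succ k => trivial

end PVSCert

namespace LPEnc

open TSM PVSCert

theorem el_subst (t : LTerm) (σ) : (el t).subst σ = el (t.subst σ) := by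
  simp only [el, Term.subst]; congr 1; funext i; fin_cases i; rfl

theorem prf_subst (t : LTerm) (σ) : (prf t).subst σ = prf (t.subst σ) := by
  simp only [prf, Term.subst]; congr 1; funext i; fin_cases i; rfl

theorem all_subst (t u : LTerm) (σ) : (all t u).subst σ = all (t.subst σ) (u.subst σ) := by
  simp only [all, Term.subst]; congr 1; funext i; fin_cases i <;> rfl

theorem imp_subst (t u : LTerm) (σ) : (imp t u).subst σ = imp (t.subst σ) (u.subst σ) := by
  simp only [imp, Term.subst]; congr 1; funext i; fin_cases i <;> rfl

theorem arr_subst (t u : LTerm) (σ) : (arr t u).subst σ = arr (t.subst σ) (u.subst σ) := by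
  simp only [arr, Term.subst]; congr 1; funext i; fin_cases i <;> rfl

/-- The type of the objects encoded by `t`, for `t` encoding a type or a proposition. -/
def decode (isType : Bool) (t : LTerm) : LTerm := if isType then el t else prf t

/-- The encoding of products with a domain and a codomain of the given levels. -/
def prodSym : Bool → Bool → LTerm → LTerm → LTerm
  | true, true => arr
  | true, false => all
  | false, false => imp
  | false, true => fun _ _ => undef

theorem decode_subst (l : Bool) (t : LTerm) (σ) :
    (decode l t).subst σ = decode l (t.subst σ) := by
  cases l <;> simp [decode, el_subst, prf_subst]

theorem decode_rename (l : Bool) (t : LTerm) (ρ) :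
    (decode l t).rename ρ = decode l (t.rename ρ) := by
  simp only [Term.rename_eq_subst, decode_subst]

theorem prodSym_subst (l l' : Bool) (t u : LTerm) (σ) :
    (prodSym l l' t u).subst σ = prodSym l l' (t.subst σ) (u.subst σ) := by
  cases l <;> cases l' <;>
    simp [prodSym, arr_subst, all_subst, imp_subst, undef, Term.subst]

theorem prodSym_rename (l l' : Bool) (t u : LTerm) (ρ) :
    (prodSym l l' t u).rename ρ = prodSym l l' (t.rename ρ) (u.rename ρ) := by
  simp only [Term.rename_eq_subst, prodSym_subst]

/-- The translation of terms, directed by levels instead of typings. It is defined on all terms and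
commutes with substitution unconditionally. -/
def tr : PTerm → (ℕ → Bool) → LTerm
  | .var k, _ => .var k
  | .sort .prop, _ => oProp
  | .sort .type, _ => oType
  | .sort .kind, _ => undef
  | .app M N, b => .app (tr M b) (tr N b)
  | .lam T M, b => .lam (decode (isTypeLevel T b) (tr T b)) (tr M (upLevel b))
  | .pi T U, b =>
      prodSym (isTypeLevel T b) (isTypeLevel U (upLevel b)) (tr T b)
        (.lam (decode (isTypeLevel T b) (tr T b)) (tr U (upLevel b)))
  | .sym f a, b => .sym (.pcert f) fun i => tr (a i) b

theorem tr_sort_subst (s : PSort) (b b' : ℕ → Bool) (σ) :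
    (tr (.sort s) b).subst σ = tr (.sort s) b' := by
  cases s <;> simp [tr, oProp, oType, undef, Term.subst] <;> exact Subsingleton.elim _ _

theorem tr_rename (M : PTerm) :
    ∀ ρ b, tr (M.rename ρ) b = (tr M (b ∘ ρ)).rename ρ := by
  induction M with
  | sort s => intro ρ b; rw [Term.rename_eq_subst (tr _ _), tr_sort_subst s _ b]; rfl
  | _ =>
    intro ρ b
    simp_all [Term.rename, tr, isTypeLevel_rename, upLevel_comp_upRen, decode_rename,
      prodSym_rename]

theorem tr_upSubst (σ : ℕ → PTerm) (b : ℕ → Bool) :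
    (fun k => tr (upSubst σ k) (upLevel b)) = upSubst fun k => tr (σ k) b := by
  funext k
  cases k with
  | zero => rfl
  | succ k => exact tr_rename _ _ _

theorem tr_subst (M : PTerm) :
    ∀ σ b, tr (M.subst σ) b =
      (tr M fun k => isTypeLevel (σ k) b).subst fun k => tr (σ k) b := by
  induction M with
  | sort s => intro σ b; rw [tr_sort_subst s _ b]; rfl
  | _ =>
    intro σ b
    simp_all [Term.subst, tr, isTypeLevel_subst, isTypeLevel_upSubst, decode_subst,
      prodSym_subst, tr_upSubst]

theorem tr_inst (M : PTerm) {N : PTerm} {b : ℕ → Bool} (hN : isTypeLevel N b = false) :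
    tr (M.inst N) b = (tr M (upLevel b)).inst (tr N b) := by
  rw [Term.inst, tr_subst, isTypeLevel_oneSubst hN, Term.inst]
  congr 1
  funext k; cases k <;> rfl

theorem decode_cong {l : Bool} {t t' : LTerm} (h : Cong Eqn t t') :
    Cong Eqn (decode l t) (decode l t') := by
  cases l <;> exact .sym _ fun i => by fin_cases i; exact h

theorem prodSym_cong {l l' : Bool} {t t' u u' : LTerm} (h : Cong Eqn t t') (h' : Cong Eqn u u') :
    Cong Eqn (prodSym l l' t u) (prodSym l l' t' u') := by
  cases l <;> cases l' <;> first
    | exact .refl _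
    | exact .sym _ fun i => by fin_cases i <;> assumption

theorem sym_pair_eta (a : Fin 4 → LTerm) :
    (.sym (.pcert .pair) a : LTerm) = pair (a 0) (a 1) (a 2) (a 3) := by
  rw [pair]; congr 1; funext i; fin_cases i <;> rfl

theorem sym_fst_eta (a : Fin 3 → LTerm) :
    (.sym (.pcert .fst) a : LTerm) = fst (a 0) (a 1) (a 2) := by
  rw [fst]; congr 1; funext i; fin_cases i <;> rfl

theorem sym_pair_cong {a a' : Fin 4 → LTerm} (h : ∀ i, i ≠ 3 → Cong Eqn (a i) (a' i)) :
    Cong Eqn (.sym (.pcert .pair) a) (.sym (.pcert .pair) a') := by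
  have : Cong Eqn (.sym (.pcert .pair) a)
      (.sym (.pcert .pair) (Function.update a' 3 (a 3))) := by
    refine .sym _ fun i => ?_
    by_cases hi : i = 3
    · subst hi; simpa using Cong.refl _
    · rw [Function.update_of_ne hi]; exact h i hi
  refine this.trans (.eqn ?_)
  rw [sym_pair_eta, sym_pair_eta]
  exact .pairIrrel _ _ _ _ _

/-- Reduction of well-levelled terms preserves levels and is simulated by conversion in the
encoding. This replaces subject reduction. -/
theorem wellLevelled_tr_of_par {M M' : PTerm} (h : Par M M') :
    ∀ {b}, WellLevelled M b →
      WellLevelled M' b ∧ isTypeLevel M' b = isTypeLevel M b ∧ Cong Eqn (tr M b) (tr M' b) := by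
  induction h with
  | sort s => exact fun h => ⟨h, rfl, .refl _⟩
  | var k => exact fun h => ⟨h, rfl, .refl _⟩
  | app _ _ ih ih' =>
    intro b h
    obtain ⟨h₁, h₂, h₃⟩ := ih h.1.1
    obtain ⟨h₄, h₅, h₆⟩ := ih' h.2.1
    exact ⟨⟨⟨h₁, h₂.trans h.1.2⟩, h₄, h₅.trans h.2.2⟩, rfl, .app h₃ h₆⟩
  | lam _ _ ih ih' =>
    intro b h
    obtain ⟨h₁, h₂, h₃⟩ := ih h.1
    obtain ⟨h₄, h₅, h₆⟩ := ih' h.2.1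
    refine ⟨⟨h₁, h₄, h₅.trans h.2.2⟩, rfl, ?_⟩
    rw [tr, tr, h₂]
    exact .lam (decode_cong h₃) h₆
  | pi _ _ ih ih' =>
    intro b h
    obtain ⟨h₁, h₂, h₃⟩ := ih h.1
    obtain ⟨h₄, h₅, h₆⟩ := ih' h.2.1
    refine ⟨⟨h₁, h₄, by rw [h₂, h₅]; exact h.2.2⟩, h₅, ?_⟩
    rw [tr, tr, h₂, h₅]
    exact prodSym_cong h₃ (.lam (decode_cong h₃) h₆)
  | @sym f a a' hp ih =>
    intro b h
    refine ⟨fun i hi => ?_, by simp only [isTypeLevel], ?_⟩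
    · obtain ⟨h₁, h₂, -⟩ := ih i (h i hi).1
      exact ⟨h₁, h₂.trans (h i hi).2⟩
    · by_cases hf : f = .pair
      · subst hf
        exact sym_pair_cong fun i hi => (ih i (h i fun _ h => hi (Fin.ext h)).1).2.2
      · exact .sym _ fun i => (ih i (h i fun h => (hf h).elim).1).2.2
  | beta _ _ ih ih' =>
    intro b h
    obtain ⟨h₁, h₂, h₃⟩ := ih h.1.1.2.1
    obtain ⟨h₄, h₅, h₆⟩ := ih' h.2.1
    have h₇ := h₅.trans h.2.2
    refine ⟨h₁.inst h₄ h₇, (isTypeLevel_inst _ h₇).trans (h₂.trans h.1.1.2.2), ?_⟩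
    rw [tr_inst _ h₇]
    exact (Cong.app (.lam (.refl _) h₃) h₆).trans (.eqn (.beta _ _ _))
  | @fstPair a c m ha _ ih =>
    intro b h
    have hp := h 2 (by simp)
    rw [ha] at hp
    have h₀ := hp.1 2 fun _ => by decide
    obtain ⟨h₁, h₂, h₃⟩ := ih h₀.1
    refine ⟨h₁, h₂.trans h₀.2, .trans ?_ h₃⟩
    rw [tr, sym_fst_eta, ha, tr, sym_pair_eta]
    exact .eqn (.fstPair _ _ _ _ _ _)
  | @irrel a a' _ h3 ih =>
    intro b h
    refine ⟨fun i hi => ?_, rfl, ?_⟩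
    · have hi' : i ≠ 3 := fun h => hi rfl (by rw [h]; rfl)
      obtain ⟨h₁, h₂, -⟩ := ih i hi' (h i hi).1
      exact ⟨h₁, h₂.trans (h i hi).2⟩
    · exact sym_pair_cong fun i hi => (ih i hi (h i fun _ h => hi (Fin.ext h)).1).2.2

theorem wellLevelled_tr_of_reflTransGen {M M' : PTerm} {b : ℕ → Bool}
    (h : Relation.ReflTransGen Par M M') (hM : WellLevelled M b) :
    WellLevelled M' b ∧ isTypeLevel M' b = isTypeLevel M b ∧ Cong Eqn (tr M b) (tr M' b) := by
  induction h with
  | refl => exact ⟨hM, rfl, .refl _⟩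
  | tail _ h ih =>
    obtain ⟨h₁, h₂, h₃⟩ := wellLevelled_tr_of_par h ih.1
    exact ⟨h₁, h₂.trans ih.2.1, ih.2.2.trans h₃⟩

/-- Convertible well-levelled terms have equal levels and convertible translations, even if the
conversion goes through terms that are not well levelled. -/
theorem isTypeLevel_tr_of_cong {M N : PTerm} {b : ℕ → Bool} (h : Cong PVSCert.Eqn M N)
    (hM : WellLevelled M b) (hN : WellLevelled N b) :
    isTypeLevel M b = isTypeLevel N b ∧ Cong Eqn (tr M b) (tr N b) := by
  obtain ⟨P, h₁, h₂⟩ := joinable_of_cong h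
  obtain ⟨-, h₃, h₄⟩ := wellLevelled_tr_of_reflTransGen h₁ hM
  obtain ⟨-, h₅, h₆⟩ := wellLevelled_tr_of_reflTransGen h₂ hN
  exact ⟨h₃.symm.trans h₅, h₄.trans h₆.symm⟩

theorem eq_prop_of_cong_sort {M : PTerm} {s : PSort} {b : ℕ → Bool}
    (h : Cong PVSCert.Eqn M (.sort s)) (hM : WellLevelled M b) : s = .prop :=
  (wellLevelled_tr_of_reflTransGen (reflTransGen_par_sort_of_cong h) hM).1

end LPEnc

/-! ### Derivations of PVS-Cert with explicit sorts -/

namespace PVSCert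

open TSM

/-- The judgements of PVS-Cert, with additional premises: the rules for abstractions and
applications ask for the sorts of the domain and of the codomain. -/
inductive SortedDerives : Judgement PSort PSym PSym.arity → Prop
  | empty : SortedDerives (.wf [])
  | decl {Γ T s} : SortedDerives (.typing Γ T (.sort s)) → SortedDerives (.wf (T :: Γ))
  | var {Γ k T} : SortedDerives (.wf Γ) → Γ[k]? = some T →
      SortedDerives (.typing Γ (.var k) (T.rename (· + (k + 1))))
  | conv {Γ M T U s} : SortedDerives (.typing Γ M U) → SortedDerives (.typing Γ T (.sort s)) →
      Cong Eqn T U → SortedDerives (.typing Γ M T)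
  | sort {Γ s₁ s₂} : SortedDerives (.wf Γ) → Ax s₁ s₂ →
      SortedDerives (.typing Γ (.sort s₁) (.sort s₂))
  | prod {Γ T U s₁ s₂ s₃} : SortedDerives (.typing Γ T (.sort s₁)) →
      SortedDerives (.typing (T :: Γ) U (.sort s₂)) → ProdRule s₁ s₂ s₃ →
      SortedDerives (.typing Γ (.pi T U) (.sort s₃))
  | abst {Γ T U M s₁ s₂ s₃} : SortedDerives (.typing Γ T (.sort s₁)) →
      SortedDerives (.typing (T :: Γ) U (.sort s₂)) → ProdRule s₁ s₂ s₃ →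
      SortedDerives (.typing (T :: Γ) M U) →
      SortedDerives (.typing Γ (.lam T M) (.pi T U))
  | app {Γ M N T U s₁ s₂ s₃} : SortedDerives (.typing Γ T (.sort s₁)) →
      SortedDerives (.typing (T :: Γ) U (.sort s₂)) → ProdRule s₁ s₂ s₃ →
      SortedDerives (.typing Γ M (.pi T U)) → SortedDerives (.typing Γ N T) →
      SortedDerives (.typing Γ (.app M N) (U.inst N))
  | sig {Γ} (f : PSym) {t : Fin f.arity → PTerm} : SortedDerives (.wf Γ) →
      SortedDerives (.typing (system.paramCtx f) (result f) (.sort (resultSort f))) →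
      (∀ i, SortedDerives (.typing Γ (t i) ((params f i).subst (argSubst t i)))) →
      SortedDerives (.typing Γ (.sym f t) ((result f).subst (argSubst t f.arity)))

theorem SortedDerives.derives {J : Judgement PSort PSym PSym.arity} (h : SortedDerives J) :
    system.Derives J := by
  induction h with
  | empty => exact .empty
  | decl _ ih => exact .decl ih
  | var _ hk ih => exact .var ih hk
  | conv _ _ hc ih ih' => exact .conv ih ih' hc
  | sort _ ha ih => exact .sort ih ha
  | prod _ _ hp ih ih' => exact .prod ih ih' hp
  | abst _ _ hp _ ih ih' ih'' => exact .abst (.prod ih ih' hp) ih''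
  | app _ _ _ _ _ _ _ ih ih' => exact .app ih ih'
  | sig f _ _ _ ih ih' ih'' => exact .sig f ih ih' ih''

/-- The parameter types have no free variables besides the preceding parameters, so a substitution
applied to an instance only acts on the arguments. -/
theorem params_subst (f : PSym) (t : Fin f.arity → PTerm) (i : Fin f.arity) (σ : ℕ → PTerm) :
    ((params f i).subst (argSubst t i)).subst σ =
      (params f i).subst (argSubst (fun j => (t j).subst σ) i) := by
  cases f <;> fin_cases i <;>
    simp [params, Term.arrow_subst, psub_subst, Term.subst, argSubst, PSym.arity]

theorem result_subst (f : PSym) (t : Fin f.arity → PTerm) (σ : ℕ → PTerm) :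
    ((result f).subst (argSubst t f.arity)).subst σ =
      (result f).subst (argSubst (fun j => (t j).subst σ) f.arity) := by
  cases f <;> simp [result, psub_subst, fst_subst, Term.subst, argSubst, PSym.arity]

namespace SortedDerives

/-- A renaming that respects the types of variables preserves typing. -/
theorem rename {J : Judgement PSort PSym PSym.arity} (h : SortedDerives J) :
    match J with
    | .wf _ => True
    | .typing Γ M T => ∀ (Δ : PCtx) (ρ : ℕ → ℕ), SortedDerives (.wf Δ) →
        (∀ k T, Γ[k]? = some T → ∃ T', Δ[ρ k]? = some T' ∧
          T'.rename (· + (ρ k + 1)) = (T.rename (· + (k + 1))).rename ρ) →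
        SortedDerives (.typing Δ (M.rename ρ) (T.rename ρ)) := by
  have up : ∀ {Γ Δ : PCtx} {ρ : ℕ → ℕ} (A : PTerm),
      (∀ k T, Γ[k]? = some T → ∃ T', Δ[ρ k]? = some T' ∧
        T'.rename (· + (ρ k + 1)) = (T.rename (· + (k + 1))).rename ρ) →
      ∀ k T, (A :: Γ)[k]? = some T → ∃ T', (A.rename ρ :: Δ)[upRen ρ k]? = some T' ∧
        T'.rename (· + (upRen ρ k + 1)) = (T.rename (· + (k + 1))).rename (upRen ρ) := by
    intro Γ Δ ρ A h k T hk
    cases k with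
    | zero =>
      obtain rfl : A = T := by simpa using hk
      refine ⟨_, rfl, ?_⟩
      simp only [Term.rename_rename]
      rfl
    | succ k =>
      obtain ⟨T', h₁, h₂⟩ := h k T (by simpa using hk)
      refine ⟨T', by simpa [upRen] using h₁, ?_⟩
      have := congrArg (Term.rename · Nat.succ) h₂
      simp only [Term.rename_rename] at this ⊢
      exact this
  induction h with
  | empty => trivial
  | decl => trivial
  | @var Γ k T _ hk _ =>
    intro Δ ρ hΔ hρ
    obtain ⟨T', h₁, h₂⟩ := hρ k T hk
    rw [← h₂]
    exact .var hΔ h₁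
  | conv _ _ hc ih ih' =>
    intro Δ ρ hΔ hρ
    refine .conv (ih Δ ρ hΔ hρ) (ih' Δ ρ hΔ hρ) ?_
    simp only [Term.rename_eq_subst]
    exact hc.subst (fun _ _ σ h => h.subst σ) _
  | sort _ ha => exact fun Δ ρ hΔ _ => .sort hΔ ha
  | prod _ _ hp ih ih' =>
    exact fun Δ ρ hΔ hρ =>
      .prod (ih Δ ρ hΔ hρ) (ih' _ _ (.decl (ih Δ ρ hΔ hρ)) (up _ hρ)) hp
  | abst _ _ hp _ ih ih' ih'' =>
    exact fun Δ ρ hΔ hρ =>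
      .abst (ih Δ ρ hΔ hρ) (ih' _ _ (.decl (ih Δ ρ hΔ hρ)) (up _ hρ)) hp
        (ih'' _ _ (.decl (ih Δ ρ hΔ hρ)) (up _ hρ))
  | app _ _ hp _ _ ih ih' ih₁ ih₂ =>
    intro Δ ρ hΔ hρ
    rw [Term.inst_rename]
    exact .app (ih Δ ρ hΔ hρ) (ih' _ _ (.decl (ih Δ ρ hΔ hρ)) (up _ hρ)) hp
      (ih₁ Δ ρ hΔ hρ) (ih₂ Δ ρ hΔ hρ)
  | @sig Γ f t _ hf _ _ _ ih =>
    intro Δ ρ hΔ hρ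
    rw [Term.rename_eq_subst _ ρ, Term.rename_eq_subst _ ρ, result_subst]
    refine .sig f hΔ hf fun i => ?_
    rw [← params_subst, ← Term.rename_eq_subst, ← Term.rename_eq_subst]
    exact ih i Δ ρ hΔ hρ

theorem weaken {Γ : PCtx} {A M T : PTerm} (h : SortedDerives (.typing Γ M T))
    (hA : SortedDerives (.wf (A :: Γ))) :
    SortedDerives (.typing (A :: Γ) (M.rename Nat.succ) (T.rename Nat.succ)) := by
  refine h.rename _ _ hA fun k T hk => ⟨T, by simpa using hk, ?_⟩
  rw [Term.rename_rename]
  rfl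

/-- Typing is preserved by well-typed simultaneous substitutions. -/
theorem subst {J : Judgement PSort PSym PSym.arity} (h : SortedDerives J) :
    match J with
    | .wf _ => True
    | .typing Γ M T => ∀ (Δ : PCtx) (σ : ℕ → PTerm), SortedDerives (.wf Δ) →
        (∀ k T, Γ[k]? = some T →
          SortedDerives (.typing Δ (σ k) ((T.rename (· + (k + 1))).subst σ))) →
        SortedDerives (.typing Δ (M.subst σ) (T.subst σ)) := by
  have up : ∀ {Γ Δ : PCtx} {σ : ℕ → PTerm} (A : PTerm),
      SortedDerives (.wf (A.subst σ :: Δ)) →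
      (∀ k T, Γ[k]? = some T →
        SortedDerives (.typing Δ (σ k) ((T.rename (· + (k + 1))).subst σ))) →
      ∀ k T, (A :: Γ)[k]? = some T → SortedDerives
        (.typing (A.subst σ :: Δ) (upSubst σ k) ((T.rename (· + (k + 1))).subst (upSubst σ))) := by
    intro Γ Δ σ A hA h k T hk
    cases k with
    | zero =>
      obtain rfl : A = T := by simpa using hk
      have := SortedDerives.var (k := 0) hA rfl
      rw [Term.subst_rename] at this
      rw [Term.rename_subst]
      exact this
    | succ k =>
      have := (h k T (by simpa using hk)).weaken hA
      rw [Term.rename_subst, Term.subst_rename] at this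
      rw [Term.rename_subst]
      exact this
  induction h with
  | empty => trivial
  | decl => trivial
  | @var Γ k T _ hk _ => exact fun Δ σ hΔ hσ => hσ k T hk
  | conv _ _ hc ih ih' =>
    exact fun Δ σ hΔ hσ => .conv (ih Δ σ hΔ hσ) (ih' Δ σ hΔ hσ)
      (hc.subst (fun _ _ σ h => h.subst σ) _)
  | sort _ ha => exact fun Δ σ hΔ _ => .sort hΔ ha
  | prod _ _ hp ih ih' =>
    intro Δ σ hΔ hσ
    have h := ih Δ σ hΔ hσ
    exact .prod h (ih' _ _ (.decl h) (up _ (.decl h) hσ)) hp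
  | abst _ _ hp _ ih ih' ih'' =>
    intro Δ σ hΔ hσ
    have h := ih Δ σ hΔ hσ
    exact .abst h (ih' _ _ (.decl h) (up _ (.decl h) hσ)) hp
      (ih'' _ _ (.decl h) (up _ (.decl h) hσ))
  | app _ _ hp _ _ ih ih' ih₁ ih₂ =>
    intro Δ σ hΔ hσ
    have h := ih Δ σ hΔ hσ
    rw [Term.inst_subst]
    exact .app h (ih' _ _ (.decl h) (up _ (.decl h) hσ)) hp (ih₁ Δ σ hΔ hσ) (ih₂ Δ σ hΔ hσ)
  | @sig Γ f t _ hf _ _ _ ih =>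
    intro Δ σ hΔ hσ
    rw [result_subst]
    refine .sig f hΔ hf fun i => ?_
    rw [← params_subst]
    exact ih i Δ σ hΔ hσ

theorem wf {Γ : PCtx} {M T : PTerm} (h : SortedDerives (.typing Γ M T)) :
    SortedDerives (.wf Γ) := by
  suffices H : ∀ J, SortedDerives J →
      match J with
      | .wf _ => True
      | .typing Γ _ _ => SortedDerives (.wf Γ) from H _ h
  intro J h
  induction h <;> trivial

theorem inst {Γ : PCtx} {A M N T : PTerm} (h : SortedDerives (.typing (A :: Γ) M T))
    (hN : SortedDerives (.typing Γ N A)) :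
    SortedDerives (.typing Γ (M.inst N) (T.inst N)) := by
  refine h.subst Γ (oneSubst N) hN.wf fun k T hk => ?_
  cases k with
  | zero =>
    obtain rfl : A = T := by simpa using hk
    have := Term.rename_succ_inst A N
    rw [Term.inst] at this
    exact this.symm ▸ hN
  | succ k =>
    have := SortedDerives.var (k := k) (T := T) hN.wf (by simpa using hk)
    rw [Term.rename_eq_subst] at this
    rw [Term.rename_subst]
    exact this

theorem pi_inv {Γ : PCtx} {T U C : PTerm} (h : SortedDerives (.typing Γ (.pi T U) C)) :
    ∃ s₁ s₂ s₃, SortedDerives (.typing Γ T (.sort s₁)) ∧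
      SortedDerives (.typing (T :: Γ) U (.sort s₂)) ∧ ProdRule s₁ s₂ s₃ := by
  generalize hJ : Judgement.typing Γ (.pi T U) C = J at h
  induction h generalizing C with
  | conv _ _ _ ih => cases hJ; exact ih rfl
  | prod h h' hp => cases hJ; exact ⟨_, _, _, h, h', hp⟩
  | _ => cases hJ

theorem lookup {Γ : PCtx} : SortedDerives (.wf Γ) → ∀ {k T}, Γ[k]? = some T →
    ∃ s, SortedDerives (.typing (Γ.drop (k + 1)) T (.sort s)) ∧
      SortedDerives (.typing Γ (T.rename (· + (k + 1))) (.sort s)) := by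
  induction Γ with
  | nil => intro _ k T hk; simp at hk
  | cons A Γ ih =>
    intro h k T hk
    cases h with
    | decl hA =>
      cases k with
      | zero =>
        obtain rfl : A = T := by simpa using hk
        exact ⟨_, hA, hA.weaken (.decl hA)⟩
      | succ k =>
        obtain ⟨s, h₁, h₂⟩ := ih hA.wf (k := k) (T := T) (by simpa using hk)
        refine ⟨s, h₁, ?_⟩
        have := h₂.weaken (.decl hA)
        rw [Term.rename_rename] at this
        exact this

/-- The arguments of a symbol form a well-typed substitution for its parameters. -/
theorem argSubst_typed {Γ : PCtx} {f : PSym} {t : Fin f.arity → PTerm}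
    (h : ∀ i, SortedDerives (.typing Γ (t i) ((params f i).subst (argSubst t i)))) (k : ℕ)
    (T : PTerm) (hk : (system.paramCtx f)[k]? = some T) :
    SortedDerives (.typing Γ (argSubst t f.arity k)
      ((T.rename (· + (k + 1))).subst (argSubst t f.arity))) := by
  have hlen : (system.paramCtx f).length = f.arity := by simp [System.paramCtx]
  have hlt : k < f.arity := hlen ▸ (List.getElem?_eq_some_iff.1 hk).1
  have hT : T = params f ⟨f.arity - 1 - k, by omega⟩ := by
    obtain ⟨h₁, rfl⟩ := List.getElem?_eq_some_iff.1 hk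
    simp [System.paramCtx, system]
  subst hT
  rw [Term.rename_subst]
  have h₁ : argSubst t f.arity k = t ⟨f.arity - 1 - k, by omega⟩ :=
    dif_pos ⟨hlt, by omega⟩
  have h₂ : (argSubst t f.arity ∘ fun x => x + (k + 1)) =
      argSubst t (f.arity - 1 - k) := by
    funext j
    simp only [argSubst, Function.comp_apply]
    split_ifs with h₁ h₂ h₂
    · congr 2; omega
    · omega
    · omega
    · congr 1; omega
  rw [h₁, h₂]
  exact h _

/-- Types are typed by sorts. -/
theorem type_correct {Γ : PCtx} {M T : PTerm} (h : SortedDerives (.typing Γ M T)) :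
    (∃ s, T = .sort s) ∨ ∃ s, SortedDerives (.typing Γ T (.sort s)) := by
  suffices H : ∀ J, SortedDerives J →
      match J with
      | .wf _ => True
      | .typing Γ _ T => (∃ s, T = .sort s) ∨ ∃ s, SortedDerives (.typing Γ T (.sort s)) from
    H _ h
  intro J h
  induction h with
  | empty => trivial
  | decl => trivial
  | var h hk => obtain ⟨s, -, h⟩ := h.lookup hk; exact .inr ⟨s, h⟩
  | conv _ h => exact .inr ⟨_, h⟩
  | sort => exact .inl ⟨_, rfl⟩
  | prod => exact .inl ⟨_, rfl⟩
  | abst h h' hp => exact .inr ⟨_, .prod h h' hp⟩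
  | app _ h _ _ hN => exact .inr ⟨_, h.inst hN⟩
  | sig f h hf ht => exact .inr ⟨_, hf.subst _ _ h (argSubst_typed ht)⟩

end SortedDerives

theorem sortedDerives_of_derives {J : Judgement PSort PSym PSym.arity} (h : system.Derives J) :
    SortedDerives J := by
  induction h with
  | empty => exact .empty
  | decl _ ih => exact .decl ih
  | var _ hk ih => exact .var ih hk
  | conv _ _ hc ih ih' => exact .conv ih ih' hc
  | sort _ ha ih => exact .sort ih ha
  | prod _ _ hp ih ih' => exact .prod ih ih' hp
  | abst _ _ ih ih' =>
    obtain ⟨s₁, s₂, s₃, h₁, h₂, h₃⟩ := ih.pi_inv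
    exact .abst h₁ h₂ h₃ ih'
  | app _ _ ih ih' =>
    obtain ⟨s, hs⟩ | ⟨s, hs⟩ := ih.type_correct
    · cases hs
    · obtain ⟨s₁, s₂, s₃, h₁, h₂, h₃⟩ := hs.pi_inv
      exact .app h₁ h₂ h₃ ih ih'
  | sig f _ _ _ ih ih' ih'' => exact .sig f ih ih' ih''

end PVSCert

/-! ### Levels of typable terms -/

namespace PVSCert

open TSM

/-- The levels of the variables of a context: the type variables are those declared of type
`Type`. -/
def levels (Γ : PCtx) (k : ℕ) : Bool :=
  match Γ[k]? with
  | some (.sort .type) => true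
  | _ => false

theorem levels_cons {T : PTerm} (Γ : PCtx) (hT : T ≠ .sort .type) :
    levels (T :: Γ) = upLevel (levels Γ) := by
  funext k
  cases k with
  | zero =>
    simp only [levels, upLevel, List.getElem?_cons_zero]
    split
    · next h => exact (hT (Option.some.inj h)).elim
    · rfl
  | succ k => simp [levels, upLevel]

theorem levels_comp_add (Γ : PCtx) (n : ℕ) : levels Γ ∘ (· + n) = levels (Γ.drop n) := by
  funext k; simp [levels, Nat.add_comm]

theorem WellLevelled.ne_sort {T : PTerm} {b : ℕ → Bool} {s : PSort} (hT : WellLevelled T b)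
    (hs : s ≠ .prop) : T ≠ .sort s := by
  rintro rfl; exact hs hT

/-- The three kinds of typings in PVS-Cert: `Type : Kind`, types in `Type`, and expressions,
propositions and proofs in well-levelled types. -/
def LevelTyping (b : ℕ → Bool) (M T : PTerm) : Prop :=
  (M = .sort .type ∧ T = .sort .kind) ∨
  (WellLevelled M b ∧ isTypeLevel M b = true ∧ T = .sort .type) ∨
  (WellLevelled M b ∧ isTypeLevel M b = false ∧ WellLevelled T b)

/-- The sort `s` is the one of terms of level `l`. -/
def SortOfLevel : Bool → PSort → Prop
  | true, s => s = .type
  | false, s => s = .prop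

theorem SortOfLevel.eq_true {l : Bool} (h : SortOfLevel l .type) : l = true := by
  cases l
  · cases h
  · rfl

theorem SortOfLevel.eq_false {l : Bool} (h : SortOfLevel l .prop) : l = false := by
  cases l
  · rfl
  · cases h

theorem SortOfLevel.ne_kind {l : Bool} {s : PSort} (h : SortOfLevel l s) : s ≠ .kind := by
  rintro rfl; cases l <;> cases h

theorem LevelTyping.sort {b : ℕ → Bool} {M : PTerm} {s : PSort} (h : LevelTyping b M (.sort s)) :
    (M = .sort .type ∧ s = .kind) ∨ (WellLevelled M b ∧ SortOfLevel (isTypeLevel M b) s) := by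
  rcases h with ⟨rfl, h⟩ | ⟨h, hl, h'⟩ | ⟨h, hl, h'⟩
  · exact .inl ⟨rfl, by simpa using h⟩
  · exact .inr ⟨h, by simpa [hl, SortOfLevel] using h'⟩
  · exact .inr ⟨h, by rw [hl]; exact h'⟩

theorem LevelTyping.of_sortOfLevel {b : ℕ → Bool} {M : PTerm} {s : PSort} (h : WellLevelled M b)
    (hs : SortOfLevel (isTypeLevel M b) s) : LevelTyping b M (.sort s) := by
  cases hl : isTypeLevel M b <;> rw [hl] at hs
  · exact .inr (.inr ⟨h, hl, hs⟩)
  · exact .inr (.inl ⟨h, hl, congrArg _ hs⟩)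

theorem LevelTyping.wellLevelled {b : ℕ → Bool} {M : PTerm} {s : PSort}
    (h : LevelTyping b M (.sort s)) (hs : s ≠ .kind) :
    WellLevelled M b ∧ SortOfLevel (isTypeLevel M b) s :=
  h.sort.resolve_left fun h => hs h.2

theorem LevelTyping.object {b : ℕ → Bool} {M T : PTerm}
    (h : LevelTyping b M T) (hT : WellLevelled T b) :
    WellLevelled M b ∧ isTypeLevel M b = false := by
  rcases h with ⟨-, rfl⟩ | ⟨-, -, rfl⟩ | ⟨h, h', -⟩
  · cases hT
  · cases hT
  · exact ⟨h, h'⟩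

theorem ProdRule.ne_kind {s₁ s₂ s₃ : PSort} (h : ProdRule s₁ s₂ s₃) :
    s₁ ≠ .kind ∧ s₂ ≠ .kind ∧ s₂ = s₃ ∧ (s₂ = .type → s₁ = .type) := by
  cases h <;> simp

theorem pred_param (f : PSym) (t : Fin f.arity → PTerm) (h : 1 < f.arity := by decide) :
    (params f ⟨1, h⟩).subst (argSubst t 1) = .pi (t ⟨0, by omega⟩) (.sort .prop) := by
  cases f <;> rfl

theorem fst_param_two (t : Fin 3 → PTerm) :
    (params .fst 2).subst (argSubst t 2) = psub (t 0) (t 1) :=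
  psub_subst _ _ _

theorem pair_result (t : Fin 4 → PTerm) :
    (result .pair).subst (argSubst t 4) = psub (t 0) (t 1) :=
  psub_subst _ _ _

theorem snd_result (t : Fin 3 → PTerm) :
    (result .snd).subst (argSubst t 3) = .app (t 1) (fst (t 0) (t 1) (t 2)) :=
  congrArg (Term.app (t 1)) (fst_subst _ _ _ _)

theorem wellLevelled_psub {T p : PTerm} {b : ℕ → Bool}
    (hT : WellLevelled T b ∧ isTypeLevel T b = true)
    (hp : WellLevelled p b ∧ isTypeLevel p b = false) : WellLevelled (psub T p) b := by
  intro i _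
  fin_cases i
  exacts [hT, hp]

theorem wellLevelled_fst {T p m : PTerm} {b : ℕ → Bool}
    (hT : WellLevelled T b ∧ isTypeLevel T b = true)
    (hp : WellLevelled p b ∧ isTypeLevel p b = false)
    (hm : WellLevelled m b ∧ isTypeLevel m b = false) : WellLevelled (fst T p m) b := by
  intro i _
  fin_cases i
  exacts [hT, hp, hm]

/-- Arguments of the expected types are arguments of the expected levels. -/
theorem args_level {f : PSym} {t : Fin f.arity → PTerm} {b : ℕ → Bool}
    (h : ∀ i, LevelTyping b (t i) ((params f i).subst (argSubst t i))) (i : Fin f.arity)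
    (hi : f = .pair → i.val ≠ 3) :
    WellLevelled (t i) b ∧ isTypeLevel (t i) b = decide (i.val = 0) := by
  have h0 : ∀ h0 : 0 < f.arity, WellLevelled (t ⟨0, h0⟩) b ∧ isTypeLevel (t ⟨0, h0⟩) b = true := by
    intro h0
    have : LevelTyping b (t ⟨0, h0⟩) (.sort .type) := by
      have := h ⟨0, h0⟩
      cases f <;> exact this
    obtain ⟨h₁, h₂⟩ := this.wellLevelled (by simp)
    exact ⟨h₁, h₂.eq_true⟩
  have h1 : ∀ h1 : 1 < f.arity, WellLevelled (t ⟨1, h1⟩) b ∧ isTypeLevel (t ⟨1, h1⟩) b = false := by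
    intro h1
    have := h ⟨1, h1⟩
    rw [pred_param f t h1] at this
    exact this.object ⟨(h0 (by omega)).1, rfl, fun _ => (h0 (by omega)).2⟩
  have hpsub : ∀ h1 : 1 < f.arity, WellLevelled (psub (t ⟨0, by omega⟩) (t ⟨1, h1⟩)) b := fun h₁ =>
    wellLevelled_psub (h0 (by omega)) (h1 h₁)
  cases f with
  | psub => fin_cases i; exacts [h0 (by decide), h1 (by decide)]
  | pair =>
    fin_cases i
    exacts [h0 (by decide), h1 (by decide), (h 2).object (h0 (by decide)).1, (hi rfl rfl).elim]
  | fst =>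
    have h2 : LevelTyping b (t 2) (psub (t 0) (t 1)) := fst_param_two t ▸ h 2
    fin_cases i
    exacts [h0 (by decide), h1 (by decide), h2.object (hpsub (by decide))]
  | snd =>
    have h2 : LevelTyping b (t 2) (psub (t 0) (t 1)) := fst_param_two t ▸ h 2
    fin_cases i
    exacts [h0 (by decide), h1 (by decide), h2.object (hpsub (by decide))]

theorem sym_levelTyping {f : PSym} {t : Fin f.arity → PTerm} {b : ℕ → Bool}
    (h : ∀ i, LevelTyping b (t i) ((params f i).subst (argSubst t i))) :
    LevelTyping b (.sym f t) ((result f).subst (argSubst t f.arity)) := by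
  have ht := args_level h
  have hw : WellLevelled (.sym f t) b := ht
  cases f with
  | psub => exact .inr (.inl ⟨hw, rfl, rfl⟩)
  | pair =>
    refine .inr (.inr ⟨hw, rfl, ?_⟩)
    rw [pair_result]
    exact wellLevelled_psub (ht 0 fun _ => by decide) (ht 1 fun _ => by decide)
  | fst => exact .inr (.inr ⟨hw, rfl, (ht 0 fun _ => by decide).1⟩)
  | snd =>
    refine .inr (.inr ⟨hw, rfl, ?_⟩)
    rw [snd_result]
    exact ⟨ht 1 fun _ => by decide,
      wellLevelled_fst (ht 0 fun _ => by decide) (ht 1 fun _ => by decide) (ht 2 fun _ => by decide), rfl⟩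

/-- Typable terms other than `Type` are well levelled. In the conversion rule, confluence excludes that `Type` or
`Kind` is convertible with a well-levelled term. -/
theorem SortedDerives.levelTyping {J : Judgement PSort PSym PSym.arity} (h : SortedDerives J) :
    match J with
    | .wf Γ => ∀ k T, Γ[k]? = some T →
        T = .sort .type ∨ WellLevelled T (levels (Γ.drop (k + 1)))
    | .typing Γ M T => (∀ k T, Γ[k]? = some T →
        T = .sort .type ∨ WellLevelled T (levels (Γ.drop (k + 1)))) ∧
        LevelTyping (levels Γ) M T := by
  induction h with
  | empty => intro k T hk; simp at hk
  | @decl Γ A s _ ih =>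
    intro k T hk
    cases k with
    | zero =>
      obtain rfl : A = T := by simpa using hk
      exact ih.2.sort.imp And.left And.left
    | succ k => exact ih.1 k T (by simpa using hk)
  | @var Γ k T _ hk ih =>
    refine ⟨ih, ?_⟩
    rcases ih k T hk with rfl | hT
    · exact .inr (.inl ⟨trivial, by simp [isTypeLevel, levels, hk], rfl⟩)
    · refine .inr (.inr ⟨trivial, ?_, ?_⟩)
      · simp only [isTypeLevel, levels, hk]
        split
        · next h => exact (hT.ne_sort (by simp) (Option.some.inj h)).elim
        · rfl
      · rwa [wellLevelled_rename, levels_comp_add]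
  | @conv Γ M T U s _ _ hc ih ih' =>
    refine ⟨ih.1, ?_⟩
    rcases ih'.2.sort with ⟨rfl, rfl⟩ | ⟨hT, -⟩
    · rcases ih.2 with ⟨-, rfl⟩ | h | ⟨-, -, hU⟩
      · cases eq_sort_of_reflTransGen_par (reflTransGen_par_sort_of_cong hc)
      · exact .inr (.inl ⟨h.1, h.2.1, rfl⟩)
      · cases LPEnc.eq_prop_of_cong_sort hc.symm hU
    · rcases ih.2 with ⟨-, rfl⟩ | ⟨-, -, rfl⟩ | h
      · cases LPEnc.eq_prop_of_cong_sort hc hT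
      · cases LPEnc.eq_prop_of_cong_sort hc hT
      · exact .inr (.inr ⟨h.1, h.2.1, hT⟩)
  | sort _ ha ih =>
    refine ⟨ih, ?_⟩
    cases ha with
    | prop => exact .inr (.inl ⟨rfl, rfl, rfl⟩)
    | type => exact .inl ⟨rfl, rfl⟩
  | @prod Γ T U s₁ s₂ s₃ _ _ hp ih ih' =>
    obtain ⟨hk₁, hk₂, rfl, hs⟩ := hp.ne_kind
    obtain ⟨hT, hT'⟩ := ih.2.wellLevelled hk₁
    obtain ⟨hU, hU'⟩ := ih'.2.wellLevelled hk₂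
    rw [levels_cons Γ (hT.ne_sort (by simp))] at hU hU'
    refine ⟨ih.1, .of_sortOfLevel ⟨hT, hU, fun h => ?_⟩ hU'⟩
    rw [h] at hU'
    rw [hs hU'] at hT'
    exact hT'.eq_true
  | @abst Γ T U M s₁ s₂ s₃ _ _ hp _ ih ih' ihM =>
    obtain ⟨hk₁, hk₂, rfl, hs⟩ := hp.ne_kind
    obtain ⟨hT, hT'⟩ := ih.2.wellLevelled hk₁
    obtain ⟨hU, hU'⟩ := ih'.2.wellLevelled hk₂
    obtain ⟨hM, hM'⟩ := ihM.2.object hU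
    rw [levels_cons Γ (hT.ne_sort (by simp))] at hU hU' hM hM'
    refine ⟨ih.1, .inr (.inr ⟨⟨hT, hM, hM'⟩, rfl, hT, hU, fun h => ?_⟩)⟩
    rw [h] at hU'
    rw [hs hU'] at hT'
    exact hT'.eq_true
  | @app Γ M N T U s₁ s₂ s₃ _ _ hp _ _ ih ih' ihM ihN =>
    obtain ⟨hk₁, hk₂, rfl, hs⟩ := hp.ne_kind
    obtain ⟨hT, -⟩ := ih.2.wellLevelled hk₁
    obtain ⟨hU, -⟩ := ih'.2.wellLevelled hk₂
    rw [levels_cons Γ (hT.ne_sort (by simp))] at hU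
    obtain ⟨hN, hN'⟩ := ihN.2.object hT
    rcases ihM.2 with ⟨-, h⟩ | ⟨-, -, h⟩ | ⟨hM, hM', -⟩
    · cases h
    · cases h
    · exact ⟨ih.1, .inr (.inr ⟨⟨⟨hM, hM'⟩, hN, hN'⟩, rfl, hU.inst hN hN'⟩)⟩
  | sig f _ _ _ ih _ iht => exact ⟨ih, sym_levelTyping fun i => (iht i).2⟩

theorem SortedDerives.level {Γ : PCtx} {M T : PTerm} (h : SortedDerives (.typing Γ M T)) :
    LevelTyping (levels Γ) M T :=
  h.levelTyping.2

theorem level_of_hasType {Γ : PCtx} {M T : PTerm} (h : system.HasType Γ M T) :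
    LevelTyping (levels Γ) M T :=
  (sortedDerives_of_derives h).level

/-- A term typed by `Prop` or `Type` has exactly one of these types, and its level tells which. -/
theorem hasType_sort_iff {Γ : PCtx} {T : PTerm} {s : PSort} (h : system.HasType Γ T (.sort s))
    (hs : s ≠ .kind) :
    (system.HasType Γ T (.sort .type) ↔ isTypeLevel T (levels Γ) = true) ∧
      (system.HasType Γ T (.sort .prop) ↔ isTypeLevel T (levels Γ) = false) := by
  have h₁ := ((level_of_hasType h).wellLevelled hs).2
  refine ⟨⟨fun h' => ?_, fun hl => ?_⟩, fun h' => ?_, fun hl => ?_⟩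
  · exact ((level_of_hasType h').wellLevelled (by simp)).2.eq_true
  · rw [hl] at h₁; cases h₁; exact h
  · exact ((level_of_hasType h').wellLevelled (by simp)).2.eq_false
  · rw [hl] at h₁; cases h₁; exact h

end PVSCert

/-! ### Agreement of the level-directed translation with the typing-directed one -/

namespace LPEnc

open TSM PVSCert

/-- The level-directed translation of types. -/
def trTy : PTerm → (ℕ → Bool) → LTerm
  | .sort .kind, _ => cKind
  | .sort .type, _ => cType
  | T, b => decode (isTypeLevel T b) (tr T b)

theorem trTy_of_wellLevelled {T : PTerm} {b : ℕ → Bool} (h : WellLevelled T b) :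
    trTy T b = decode (isTypeLevel T b) (tr T b) := by
  unfold trTy
  split
  · cases h
  · cases h
  · rfl

theorem typeTrOf_eq {Γ : PCtx} {T : PTerm} {s : PSort} (h : PVSCert.system.HasType Γ T (.sort s))
    (hs : s ≠ .kind) (t : LTerm) :
    typeTrOf Γ T t = decode (isTypeLevel T (levels Γ)) t := by
  have hT := ((level_of_hasType h).wellLevelled hs).1
  obtain ⟨h₁, h₂⟩ := hasType_sort_iff h hs
  rw [typeTrOf, if_neg (hT.ne_sort (by simp)), if_neg (hT.ne_sort (by simp))]
  cases hl : isTypeLevel T (levels Γ)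
  · rw [if_neg (by rw [h₁, hl]; simp), if_pos (h₂.2 hl)]; rfl
  · rw [if_pos (h₁.2 hl)]; rfl

theorem termTr_eq {J : Judgement PSort PSym PSym.arity} (h : SortedDerives J) :
    match J with
    | .wf _ => True
    | .typing Γ M _ => termTr M Γ = tr M (levels Γ) := by
  induction h with
  | empty => trivial
  | decl => trivial
  | var => simp [termTr, tr]
  | conv _ _ _ ih => exact ih
  | sort _ ha => cases ha <;> simp [termTr, tr]
  | @prod Γ T U s₁ s₂ s₃ hT hU hp ih ih' =>
    obtain ⟨hk₁, hk₂, -, -⟩ := hp.ne_kind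
    obtain ⟨h₁, h₂⟩ := hasType_sort_iff hT.derives hk₁
    obtain ⟨h₃, h₄⟩ := hasType_sort_iff hU.derives hk₂
    have hT₀ := (hT.level.wellLevelled hk₁).1
    simp only [termTr, tr]
    rw [typeTrOf_eq hT.derives hk₁, h₁, h₂, h₃, h₄, ih, ih',
      levels_cons Γ (hT₀.ne_sort (by simp))]
    cases hl : isTypeLevel T (levels Γ) <;>
      cases hl' : isTypeLevel U (upLevel (levels Γ)) <;> simp [prodSym]
  | @abst Γ T U M s₁ s₂ s₃ hT _ hp _ ih _ ih' =>
    obtain ⟨hk₁, -⟩ := hp.ne_kind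
    have hT₀ := (hT.level.wellLevelled hk₁).1
    simp only [termTr, tr]
    rw [typeTrOf_eq hT.derives hk₁, ih, ih', levels_cons Γ (hT₀.ne_sort (by simp))]
  | app _ _ _ _ _ _ _ ih ih' => simp only [termTr, tr, ih, ih']
  | sig f _ _ _ _ _ ih => simp only [termTr, tr, ih]

theorem typeTr_eq_of_hasType_sort {Γ : PCtx} {T : PTerm} {s : PSort}
    (h : SortedDerives (.typing Γ T (.sort s))) : typeTr T Γ = trTy T (levels Γ) := by
  rcases h.level.sort with ⟨rfl, -⟩ | ⟨hT, hs⟩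
  · simp [typeTr, typeTrOf, trTy]
  · rw [typeTr, typeTrOf_eq h.derives hs.ne_kind, trTy_of_wellLevelled hT, show termTr T Γ = _ from termTr_eq h]

theorem typeTr_eq {Γ : PCtx} {M T : PTerm} (h : SortedDerives (.typing Γ M T)) :
    typeTr T Γ = trTy T (levels Γ) := by
  obtain ⟨s, rfl⟩ | ⟨s, hs⟩ := h.type_correct
  · cases s with
    | prop => exact typeTr_eq_of_hasType_sort (.sort h.wf .prop)
    | type => exact typeTr_eq_of_hasType_sort (.sort h.wf .type)
    | kind => simp [typeTr, typeTrOf, trTy]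
  · exact typeTr_eq_of_hasType_sort hs

/-- The level-directed translation of contexts. -/
def trCtx : PCtx → LCtx
  | [] => []
  | T :: Γ => trTy T (levels Γ) :: trCtx Γ

theorem ctxTr_eq {Γ : PCtx} (h : SortedDerives (.wf Γ)) : ctxTr Γ = trCtx Γ := by
  induction Γ with
  | nil => rfl
  | cons T Γ ih =>
    cases h with
    | decl hT => rw [ctxTr, trCtx, typeTr_eq_of_hasType_sort hT, ih hT.wf]

end LPEnc

/-! ### Derivations in the encoding -/

namespace LPEnc

open TSM PVSCert

theorem sym_nullary_subst (f : LSym) (hf : f.arity = 0) (a : Fin f.arity → LTerm) (σ) :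
    (Term.sym f a : LTerm).subst σ = .sym f a := by
  rw [Term.subst]; congr 1; funext i; exact (Fin.cast hf i).elim0

theorem cType_subst (σ) : cType.subst σ = cType := sym_nullary_subst .cType rfl _ σ

theorem cProp_subst (σ) : cProp.subst σ = cProp := sym_nullary_subst .cProp rfl _ σ

theorem cType_rename (ρ) : cType.rename ρ = cType := by rw [Term.rename_eq_subst, cType_subst]

theorem psub_subst (t p : LTerm) (σ) : (psub t p).subst σ = psub (t.subst σ) (p.subst σ) := by
  simp only [psub, Term.subst]; congr 1; funext i; fin_cases i <;> rfl

theorem fst_subst (t p m : LTerm) (σ) :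
    (fst t p m).subst σ = fst (t.subst σ) (p.subst σ) (m.subst σ) := by
  simp only [fst, Term.subst]; congr 1; funext i; fin_cases i <;> rfl

theorem el_rename (t : LTerm) (ρ) : (el t).rename ρ = el (t.rename ρ) := decode_rename true t ρ

theorem arrow_rename (t u : LTerm) (ρ) :
    (Term.arrow t u).rename ρ = .arrow (t.rename ρ) (u.rename ρ) := by
  simp only [Term.rename_eq_subst, Term.arrow_subst]

variable {Γ : LCtx}

theorem var_typed {k : ℕ} {A B : LTerm} (h : system.WF Γ) (hk : Γ[k]? = some A)
    (hB : A.rename (· + (k + 1)) = B) : system.HasType Γ (.var k) B :=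
  hB ▸ .var h hk

theorem nullary_typed (f : LSym) (hf : f.arity = 0) (h : system.WF Γ)
    (hr : system.HasType [] (result f) (.sort (resultSort f)))
    (hs : ∀ σ, (result f).subst σ = result f)
    (a : Fin f.arity → LTerm) : system.HasType Γ (.sym f a) (result f) := by
  have hp : system.paramCtx f = [] := by
    rw [← List.length_eq_zero_iff]; simp [System.paramCtx, hf]
  have := System.Derives.sig (X := system) (t := a) f h (hp ▸ hr)
    fun i => (Fin.cast hf i).elim0
  rwa [show system.result f = result f from rfl, hs] at this

theorem cKind_typed (h : system.WF Γ) : system.HasType Γ cKind (.sort .type) :=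
  nullary_typed .cKind rfl h (.sort .empty .type) (fun _ => rfl) _

theorem cType_typed (h : system.WF Γ) : system.HasType Γ cType (.sort .type) :=
  nullary_typed .cType rfl h (.sort .empty .type) (fun _ => rfl) _

theorem cProp_typed (h : system.WF Γ) : system.HasType Γ cProp (.sort .type) :=
  nullary_typed .cProp rfl h (.sort .empty .type) (fun _ => rfl) _

theorem oType_typed (h : system.WF Γ) : system.HasType Γ oType cKind :=
  nullary_typed .oType rfl h (cKind_typed .empty) (sym_nullary_subst .cKind rfl _) _

theorem oProp_typed (h : system.WF Γ) : system.HasType Γ oProp cType :=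
  nullary_typed .oProp rfl h (cType_typed .empty) cType_subst _

theorem el_typed {t : LTerm} (h : system.HasType Γ t cType) :
    system.HasType Γ (el t) (.sort .type) := by
  have hΓ : system.WF [cType] := .decl (cType_typed .empty)
  refine System.Derives.sig (X := system) .el (t := ![t]) h.wf (.sort hΓ .type) fun i => ?_
  fin_cases i
  exact (cType_subst _).symm ▸ h

theorem prf_typed {p : LTerm} (h : system.HasType Γ p cProp) :
    system.HasType Γ (prf p) (.sort .type) := by
  have hΓ : system.WF [cProp] := .decl (cProp_typed .empty)
  refine System.Derives.sig (X := system) .prf (t := ![p]) h.wf (.sort hΓ .type) fun i => ?_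
  fin_cases i
  exact (cProp_subst _).symm ▸ h

/-- The type of codes for types, respectively propositions. -/
def codeTy (isType : Bool) : LTerm := if isType then cType else cProp

theorem codeTy_subst (l : Bool) (σ) : (codeTy l).subst σ = codeTy l := by
  cases l
  · exact cProp_subst σ
  · exact cType_subst σ

theorem codeTy_rename (l : Bool) (ρ) : (codeTy l).rename ρ = codeTy l := by
  rw [Term.rename_eq_subst, codeTy_subst]

theorem codeTy_typed (l : Bool) (h : system.WF Γ) : system.HasType Γ (codeTy l) (.sort .type) := by
  cases l
  · exact cProp_typed h
  · exact cType_typed h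

theorem decode_typed {l : Bool} {t : LTerm} (h : system.HasType Γ t (codeTy l)) :
    system.HasType Γ (decode l t) (.sort .type) := by
  cases l
  · exact prf_typed h
  · exact el_typed h

theorem arrow_codeTy (t : LTerm) (l : Bool) : Term.arrow t (codeTy l) = .pi t (codeTy l) := by
  rw [Term.arrow, codeTy_rename]

theorem arrow_typed {t : LTerm} (l : Bool) (h : system.HasType Γ t (.sort .type)) :
    system.HasType Γ (.arrow t (codeTy l)) (.sort .type) := by
  rw [arrow_codeTy]
  exact .prod h (codeTy_typed l (.decl h)) .ttt

theorem app_typed {t m p : LTerm} {l : Bool} (hp : system.HasType Γ p (.arrow t (codeTy l)))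
    (hm : system.HasType Γ m t) : system.HasType Γ (.app p m) (codeTy l) := by
  rw [arrow_codeTy] at hp
  have := System.Derives.app hp hm
  rwa [Term.inst, codeTy_subst] at this

/-- The context of a code and a family of codes over it. -/
def familyCtx (l l' : Bool) : LCtx := [.arrow (decode l (.var 0)) (codeTy l'), codeTy l]

theorem familyCtx_wf (l l' : Bool) : system.WF (familyCtx l l') := by
  have h : system.WF [codeTy l] := .decl (codeTy_typed l .empty)
  exact .decl (arrow_typed l' (decode_typed (var_typed h rfl (codeTy_rename _ _))))

theorem family_param (l l' : Bool) {n : ℕ} (t : Fin (n + 1) → LTerm) :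
    (Term.arrow (decode l (.var 0)) (codeTy l')).subst (argSubst t 1) =
      .arrow (decode l (t 0)) (codeTy l') := by
  rw [Term.arrow_subst, decode_subst, codeTy_subst]; rfl

/-- The symbols `all`, `imp` and `arr` are typed uniformly in the levels. -/
theorem prodSym_typed {l l' : Bool} (hl : l' = true → l = true) {t u : LTerm}
    (ht : system.HasType Γ t (codeTy l))
    (hu : system.HasType Γ u (.arrow (decode l t) (codeTy l'))) :
    system.HasType Γ (prodSym l l' t u) (codeTy l') := by
  have hr := codeTy_typed l' (familyCtx_wf l l')
  have h0 : ∀ σ, system.HasType Γ t ((codeTy l).subst σ) := fun σ => (codeTy_subst l σ).symm ▸ ht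
  have h1 := (family_param l l' ![t, u]).symm ▸ hu
  cases l <;> cases l'
  · exact codeTy_subst false _ ▸ System.Derives.sig (X := system) .imp (t := ![t, u]) ht.wf hr
      fun i => by fin_cases i; exacts [h0 _, h1]
  · simp at hl
  · exact codeTy_subst false _ ▸ System.Derives.sig (X := system) .all (t := ![t, u]) ht.wf hr
      fun i => by fin_cases i; exacts [h0 _, h1]
  · exact codeTy_subst true _ ▸ System.Derives.sig (X := system) .arr (t := ![t, u]) ht.wf hr
      fun i => by fin_cases i; exacts [h0 _, h1]

theorem psub_typed {t p : LTerm} (ht : system.HasType Γ t cType)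
    (hp : system.HasType Γ p (.arrow (el t) cProp)) : system.HasType Γ (psub t p) cType := by
  have h1 := (family_param true false ![t, p]).symm ▸ hp
  exact cType_subst _ ▸ System.Derives.sig (X := system) (.pcert .psub) (t := ![t, p]) ht.wf
    (cType_typed (familyCtx_wf true false))
    fun i => by fin_cases i; exacts [(cType_subst _).symm ▸ ht, h1]

/-- The parameters `t` and `p` seen in an extension of their context by `n` declarations. -/
theorem family_vars {Δ : LCtx} {n : ℕ} (h : system.WF Δ) (hΔ : Δ.drop n = familyCtx true false) :
    system.HasType Δ (.var (n + 1)) cType ∧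
      system.HasType Δ (.var n) (.arrow (el (.var (n + 1))) cProp) := by
  have hk : ∀ k, Δ[n + k]? = (familyCtx true false)[k]? := fun k => by
    rw [← hΔ, List.getElem?_drop]
  refine ⟨var_typed h (hk 1) (cType_rename _), var_typed h (hk 0) ?_⟩
  rw [arrow_rename, decode_rename, codeTy_rename]
  simp [Term.rename, decode, codeTy]

theorem pair_typed {t p m q : LTerm} (ht : system.HasType Γ t cType)
    (hp : system.HasType Γ p (.arrow (el t) cProp)) (hm : system.HasType Γ m (el t))
    (hq : system.HasType Γ q (prf (.app p m))) :
    system.HasType Γ (pair t p m q) (el (psub t p)) := by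
  have hw : system.WF (el (.var 1) :: familyCtx true false) :=
    .decl (el_typed (family_vars (n := 0) (familyCtx_wf _ _) rfl).1)
  have hw' : system.WF (prf (.app (.var 1) (.var 0)) :: el (.var 1) :: familyCtx true false) :=
    .decl (prf_typed (app_typed (l := false) (family_vars (n := 1) hw rfl).2
      (var_typed hw rfl (el_rename _ _))))
  have hr := el_typed (psub_typed (family_vars (n := 2) hw' rfl).1 (family_vars (n := 2) hw' rfl).2)
  have h1 := (family_param true false ![t, p, m, q]).symm ▸ hp
  have := System.Derives.sig (X := system) (.pcert .pair) (t := ![t, p, m, q]) ht.wf hr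
    fun i => by
      fin_cases i
      · exact (cType_subst _).symm ▸ ht
      · exact h1
      · exact (el_subst _ _).symm ▸ hm
      · exact (prf_subst _ _).symm ▸ hq
  have he : (el (psub (.var 3) (.var 2))).subst (argSubst ![t, p, m, q] 4) = el (psub t p) := by
    rw [el_subst, psub_subst]; rfl
  exact he ▸ this

/-- The context of the parameters of both projections. -/
def projCtx : LCtx := el (psub (.var 1) (.var 0)) :: familyCtx true false

theorem projCtx_wf : system.WF projCtx :=
  have h := family_vars (n := 0) (familyCtx_wf _ _) rfl
  .decl (el_typed (psub_typed h.1 h.2))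

theorem proj_args {t p m : LTerm} (ht : system.HasType Γ t cType)
    (hp : system.HasType Γ p (.arrow (el t) cProp)) (hm : system.HasType Γ m (el (psub t p)))
    (i : Fin 3) :
    system.HasType Γ (![t, p, m] i) ((params (.pcert .fst) i).subst (argSubst ![t, p, m] i)) := by
  have h1 := (family_param true false ![t, p, m]).symm ▸ hp
  have h2 : (el (psub (.var 1) (.var 0))).subst (argSubst ![t, p, m] 2) = el (psub t p) := by
    rw [el_subst, psub_subst]; rfl
  fin_cases i
  · exact (cType_subst _).symm ▸ ht
  · exact h1
  · exact h2.symm ▸ hm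

theorem fst_typed {t p m : LTerm} (ht : system.HasType Γ t cType)
    (hp : system.HasType Γ p (.arrow (el t) cProp)) (hm : system.HasType Γ m (el (psub t p))) :
    system.HasType Γ (fst t p m) (el t) := by
  have := System.Derives.sig (X := system) (.pcert .fst) (t := ![t, p, m]) ht.wf
    (el_typed (family_vars (n := 1) projCtx_wf rfl).1) (proj_args ht hp hm)
  have he : (el (.var 2)).subst (argSubst ![t, p, m] 3) = el t := el_subst _ _
  exact he ▸ this

theorem snd_typed {t p m : LTerm} (ht : system.HasType Γ t cType)
    (hp : system.HasType Γ p (.arrow (el t) cProp)) (hm : system.HasType Γ m (el (psub t p))) :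
    system.HasType Γ (snd t p m) (prf (.app p (fst t p m))) := by
  have hv := family_vars (n := 1) projCtx_wf rfl
  have h0 : system.HasType projCtx (.var 0) (el (psub (.var 2) (.var 1))) :=
    var_typed projCtx_wf rfl (by rw [el_rename, Term.rename_eq_subst, psub_subst]; rfl)
  have hr := prf_typed (app_typed (l := false) hv.2 (fst_typed hv.1 hv.2 h0))
  have := System.Derives.sig (X := system) (.pcert .snd) (t := ![t, p, m]) ht.wf hr
    (proj_args ht hp hm)
  have he : (prf (.app (.var 1) (fst (.var 2) (.var 1) (.var 0)))).subst
      (argSubst ![t, p, m] 3) = prf (.app p (fst t p m)) := by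
    rw [prf_subst, Term.subst, fst_subst]; rfl
  exact he ▸ this

/-! ### Correctness -/

/-- Decoding the encoding of a product yields the product of the decoded types. -/
theorem decode_prodSym {l l' : Bool} (hl : l' = true → l = true) (t u : LTerm) :
    Cong Eqn (decode l' (prodSym l l' t (.lam (decode l t) u)))
      (.pi (decode l t) (decode l' u)) := by
  have hβ : Cong Eqn (.app ((Term.lam (decode l t) u).rename Nat.succ) (.var 0)) u := by
    have := Eqn.beta ((decode l t).rename Nat.succ) (u.rename (upRen Nat.succ)) (.var 0)
    rw [Term.rename_upRen_succ_inst] at this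
    exact .eqn this
  refine .trans (.eqn ?_) (.pi (.refl _) (decode_cong hβ))
  cases l <;> cases l'
  · exact .prfImp _ _
  · simp at hl
  · exact .prfAll _ _
  · exact .elArr _ _

theorem hasType_trTy_sort_iff {l : Bool} {s : PSort} (hs : SortOfLevel l s) {t : LTerm}
    {b : ℕ → Bool} :
    system.HasType Γ t (trTy (.sort s) b) ↔ system.HasType Γ t (codeTy l) := by
  cases l <;> cases hs
  · exact ⟨fun h => .conv h (cProp_typed h.wf) (.symm (.eqn .elProp)),
      fun h => .conv h (el_typed (oProp_typed h.wf)) (.eqn .elProp)⟩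
  · exact Iff.rfl

theorem trTy_typed {T : PTerm} {b : ℕ → Bool} {s : PSort} (hT : LevelTyping b T (.sort s))
    (h : system.HasType Γ (tr T b) (trTy (.sort s) b)) :
    system.HasType Γ (trTy T b) (.sort .type) := by
  rcases hT.sort with ⟨rfl, -⟩ | ⟨hT, hs⟩
  · exact cType_typed h.wf
  · rw [trTy_of_wellLevelled hT]
    exact decode_typed ((hasType_trTy_sort_iff hs).1 h)

theorem trTy_cong {M T U : PTerm} {b : ℕ → Bool} {s : PSort} (hM : LevelTyping b M U)
    (hT : LevelTyping b T (.sort s)) (h : Cong PVSCert.Eqn T U) :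
    Cong Eqn (trTy T b) (trTy U b) := by
  rcases hT.sort with ⟨rfl, -⟩ | ⟨hT, -⟩ <;> rcases hM with ⟨-, rfl⟩ | ⟨-, -, rfl⟩ | ⟨-, -, hU⟩
  · cases eq_sort_of_reflTransGen_par (reflTransGen_par_sort_of_cong h)
  · exact .refl _
  · cases eq_prop_of_cong_sort h.symm hU
  · cases eq_prop_of_cong_sort h hT
  · cases eq_prop_of_cong_sort h hT
  · obtain ⟨h₁, h₂⟩ := isTypeLevel_tr_of_cong h hT hU
    rw [trTy_of_wellLevelled hT, trTy_of_wellLevelled hU, h₁]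
    exact decode_cong h₂

theorem trTy_rename {T : PTerm} {b : ℕ → Bool} (ρ : ℕ → ℕ) :
    trTy (T.rename ρ) b = (trTy T (b ∘ ρ)).rename ρ := by
  have hd : ∀ T : PTerm, decode (isTypeLevel (T.rename ρ) b) (tr (T.rename ρ) b) =
      (decode (isTypeLevel T (b ∘ ρ)) (tr T (b ∘ ρ))).rename ρ := fun T => by
    rw [isTypeLevel_rename, tr_rename, decode_rename]
  cases T with
  | sort s =>
    cases s with
    | prop => exact hd (.sort .prop)
    | type => exact (cType_rename ρ).symm
    | kind =>
      rw [Term.rename_eq_subst (trTy _ _)]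
      exact (sym_nullary_subst .cKind rfl _ _).symm
  | var k => exact hd (.var k)
  | app M N => exact hd (.app M N)
  | lam T M => exact hd (.lam T M)
  | pi T U => exact hd (.pi T U)
  | sym f a => exact hd (.sym f a)

theorem trCtx_getElem? {Γ : PCtx} {k : ℕ} {T : PTerm} (h : Γ[k]? = some T) :
    (trCtx Γ)[k]? = some (trTy T (levels (Γ.drop (k + 1)))) := by
  induction Γ generalizing k with
  | nil => simp at h
  | cons A Γ ih =>
    cases k with
    | zero =>
      obtain rfl : A = T := by simpa using h
      rfl
    | succ k => exact ih (by simpa using h)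

/-- Products in the encoding, from the translations of their components. -/
theorem pi_typed {T U : PTerm} {b : ℕ → Bool}
    (hl : isTypeLevel U (upLevel b) = true → isTypeLevel T b = true)
    (hT : system.HasType Γ (tr T b) (codeTy (isTypeLevel T b)))
    (hU : system.HasType (decode (isTypeLevel T b) (tr T b) :: Γ) (tr U (upLevel b))
      (codeTy (isTypeLevel U (upLevel b)))) :
    system.HasType Γ (tr (.pi T U) b) (codeTy (isTypeLevel (.pi T U) b)) := by
  refine prodSym_typed hl hT ?_
  rw [arrow_codeTy]
  have hT' := decode_typed hT
  exact .abst (.prod hT' (codeTy_typed _ (.decl hT')) .ttt) hU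

theorem pred_conv {t : PTerm} {b : ℕ → Bool} {p : LTerm} (hl : isTypeLevel t b = true)
    (ht : system.HasType Γ (tr t b) cType)
    (hp : system.HasType Γ p (trTy (.pi t (.sort .prop)) b)) :
    system.HasType Γ p (.arrow (el (tr t b)) cProp) := by
  refine .conv hp (arrow_typed false (el_typed ht)) (.symm ?_)
  have := decode_prodSym (l := isTypeLevel t b) (l' := true) (fun _ => hl) (tr t b) oProp
  refine .trans this ?_
  rw [show cProp = codeTy false from rfl, arrow_codeTy, hl]
  exact .pi (.refl _) (.eqn .elProp)

theorem sym_psub_eta (a : Fin 2 → LTerm) :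
    (.sym (.pcert .psub) a : LTerm) = psub (a 0) (a 1) := by
  rw [psub]; congr 1; funext i; fin_cases i <;> rfl

theorem sym_snd_eta (a : Fin 3 → LTerm) :
    (.sym (.pcert .snd) a : LTerm) = snd (a 0) (a 1) (a 2) := by
  rw [snd]; congr 1; funext i; fin_cases i <;> rfl

theorem tr_psub (t p : PTerm) (b : ℕ → Bool) :
    tr (PVSCert.psub t p) b = psub (tr t b) (tr p b) := by
  rw [PVSCert.psub, tr, psub]; congr 1; funext i; fin_cases i <;> rfl

theorem tr_fst (t p m : PTerm) (b : ℕ → Bool) :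
    tr (PVSCert.fst t p m) b = fst (tr t b) (tr p b) (tr m b) := by
  rw [PVSCert.fst, tr, fst]; congr 1; funext i; fin_cases i <;> rfl

theorem sym_typed {f : PSym} {t : Fin f.arity → PTerm} {b : ℕ → Bool}
    (hl : ∀ i, LevelTyping b (t i) ((PVSCert.params f i).subst (argSubst t i)))
    (h : ∀ i, system.HasType Γ (tr (t i) b)
      (trTy ((PVSCert.params f i).subst (argSubst t i)) b)) :
    system.HasType Γ (tr (.sym f t) b)
      (trTy ((PVSCert.result f).subst (argSubst t f.arity)) b) := by
  have hlev := args_level hl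
  have h0 : ∀ h0 : 0 < f.arity, system.HasType Γ (tr (t ⟨0, h0⟩) b) cType := fun h0 => by
    have := h ⟨0, h0⟩
    cases f <;> exact this
  have h1 : ∀ h1 : 1 < f.arity, system.HasType Γ (tr (t ⟨1, h1⟩) b)
      (.arrow (el (tr (t ⟨0, by omega⟩) b)) cProp) := fun h1 => by
    have := h ⟨1, h1⟩
    rw [pred_param f t h1] at this
    exact pred_conv (hlev ⟨0, by omega⟩ fun _ => by simp).2 (h0 (by omega)) this
  have hel : ∀ (h0 : 0 < f.arity), trTy (t ⟨0, h0⟩) b = el (tr (t ⟨0, h0⟩) b) := fun h0 => by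
    obtain ⟨h₁, h₂⟩ := hlev ⟨0, h0⟩ fun _ => by simp
    rw [trTy_of_wellLevelled h₁, h₂]; rfl
  have hpsub : ∀ x y : PTerm, trTy (PVSCert.psub x y) b = el (psub (tr x b) (tr y b)) :=
    fun x y => by rw [← tr_psub]; rfl
  cases f with
  | psub =>
    have := psub_typed (h0 (by decide)) (h1 (by decide))
    rw [tr, sym_psub_eta]
    exact this
  | pair =>
    rw [pair_result, hpsub, tr, sym_pair_eta]
    exact pair_typed (h0 (by decide)) (h1 (by decide)) (hel (by decide) ▸ h 2) (h 3)
  | fst =>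
    have h2 := h 2
    rw [show (PVSCert.params .fst 2).subst (argSubst t (2 : Fin 3)) = _ from fst_param_two t,
      hpsub] at h2
    rw [tr, sym_fst_eta]
    exact hel (by decide) ▸ fst_typed (h0 (by decide)) (h1 (by decide)) h2
  | snd =>
    have h2 := h 2
    rw [show (PVSCert.params .snd 2).subst (argSubst t (2 : Fin 3)) = _ from fst_param_two t,
      hpsub] at h2
    rw [snd_result, tr, sym_snd_eta]
    have := snd_typed (h0 (by decide)) (h1 (by decide)) h2
    rw [← tr_fst] at this
    exact this

/-- Correctness of the level-directed translation, by induction on derivations. -/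
theorem tr_correct {J : Judgement PSort PSym PSym.arity} (h : SortedDerives J) :
    match J with
    | .wf Γ => system.WF (trCtx Γ)
    | .typing Γ M T =>
        system.HasType (trCtx Γ) (tr M (levels Γ)) (trTy T (levels Γ)) := by
  induction h with
  | empty => exact .empty
  | decl h ih => exact .decl (trTy_typed h.level ih)
  | @var Γ k T _ hk ih =>
    refine var_typed ih (trCtx_getElem? hk) ?_
    rw [trTy_rename, levels_comp_add]
  | conv h h' hc ih ih' =>
    exact .conv ih (trTy_typed h'.level ih') (trTy_cong h.level h'.level hc)
  | sort _ ha ih =>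
    cases ha with
    | prop => exact oProp_typed ih
    | type => exact oType_typed ih
  | @prod Γ T U s₁ s₂ s₃ h h' hp ih ih' =>
    obtain ⟨hk₁, hk₂, rfl, -⟩ := hp.ne_kind
    obtain ⟨hT, hT'⟩ := h.level.wellLevelled hk₁
    obtain ⟨hU, hU'⟩ := h'.level.wellLevelled hk₂
    obtain ⟨hP, -⟩ := (SortedDerives.prod h h' hp).level.wellLevelled hk₂
    have hc := levels_cons Γ (hT.ne_sort (s := .type) (by simp))
    rw [hc] at hU'
    simp only [trCtx, hc, trTy_of_wellLevelled hT] at ih'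
    exact (hasType_trTy_sort_iff hU').2 (pi_typed hP.2.2 ((hasType_trTy_sort_iff hT').1 ih)
      ((hasType_trTy_sort_iff hU').1 ih'))
  | @abst Γ T U M s₁ s₂ s₃ h h' hp hM ih ih' ihM =>
    dsimp only at ih ih' ihM ⊢
    obtain ⟨hk₁, hk₂, rfl, -⟩ := hp.ne_kind
    obtain ⟨hT, hT'⟩ := h.level.wellLevelled hk₁
    obtain ⟨hU, hU'⟩ := h'.level.wellLevelled hk₂
    obtain ⟨hP, -⟩ := (SortedDerives.prod h h' hp).level.wellLevelled hk₂
    have hc := levels_cons Γ (hT.ne_sort (s := .type) (by simp))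
    rw [hc] at hU hU'
    simp only [trCtx, hc, trTy_of_wellLevelled hT] at ih' ihM
    rw [trTy_of_wellLevelled hU] at ihM
    have h₁ := (hasType_trTy_sort_iff hT').1 ih
    have h₂ := (hasType_trTy_sort_iff hU').1 ih'
    rw [trTy_of_wellLevelled hP]
    exact .conv (.abst (.prod (decode_typed h₁) (decode_typed h₂) .ttt) ihM)
      (decode_typed (pi_typed hP.2.2 h₁ h₂)) (decode_prodSym hP.2.2 _ _)
  | @app Γ M N T U s₁ s₂ s₃ h h' hp hM hN ih ih' ihM ihN =>
    dsimp only at ih ih' ihM ihN ⊢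
    obtain ⟨hk₁, hk₂, rfl, -⟩ := hp.ne_kind
    obtain ⟨hT, hT'⟩ := h.level.wellLevelled hk₁
    obtain ⟨hU, hU'⟩ := h'.level.wellLevelled hk₂
    obtain ⟨hP, -⟩ := (SortedDerives.prod h h' hp).level.wellLevelled hk₂
    obtain ⟨hNw, hNl⟩ := hN.level.object hT
    have hc := levels_cons Γ (hT.ne_sort (s := .type) (by simp))
    rw [hc] at hU hU'
    simp only [trCtx, hc, trTy_of_wellLevelled hT] at ih'
    have h₁ := (hasType_trTy_sort_iff hT').1 ih
    have h₂ := (hasType_trTy_sort_iff hU').1 ih'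
    rw [trTy_of_wellLevelled hP] at ihM
    rw [trTy_of_wellLevelled hT] at ihN
    have := System.Derives.app (.conv ihM
      (.prod (decode_typed h₁) (decode_typed h₂) .ttt) (decode_prodSym hP.2.2 _ _).symm) ihN
    rw [trTy_of_wellLevelled (hU.inst hNw hNl), isTypeLevel_inst U hNl, tr_inst U hNl]
    rw [Term.inst, decode_subst] at this
    exact this
  | sig f _ _ ht _ _ iht => exact sym_typed (fun i => (ht i).level) iht

end LPEnc

/-- Correctness of the encoding: the translation of PVS-Cert into the λΠ-calculus modulo theory
preserves typing and well-formedness of contexts. -/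
theorem mainTheorem1 :
    (∀ (Γ : PVSCert.PCtx) (M T : PVSCert.PTerm), PVSCert.system.HasType Γ M T →
      LPEnc.system.HasType (LPEnc.ctxTr Γ) (LPEnc.termTr M Γ) (LPEnc.typeTr T Γ)) ∧
    (∀ Γ : PVSCert.PCtx, PVSCert.system.WF Γ → LPEnc.system.WF (LPEnc.ctxTr Γ)) := by
  refine ⟨fun Γ M T h => ?_, fun Γ h => ?_⟩
  · have h' := PVSCert.sortedDerives_of_derives h
    rw [LPEnc.ctxTr_eq h'.wf, LPEnc.typeTr_eq h',
      show LPEnc.termTr M Γ = _ from LPEnc.termTr_eq h']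
    exact LPEnc.tr_correct h'
  · have h' := PVSCert.sortedDerives_of_derives h
    rw [LPEnc.ctxTr_eq h']
    exact LPEnc.tr_correct h'
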